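/- **Setting.** Let $R$ and $V$ be compact (Lipschitz, e.g. smooth) manifolds with or without boundary embedded in $\mathbb{R}^d$, with surface measures $\sigma$, $\sigma'$, where every connected component of $R$ has non-empty boundary. Let $H^1_0(R)$ carry the norm $\|\phi\|=(\int_R|\nabla\phi|^2d\sigma)^{1/2}$ and the corresponding inner product (a Hilbert space by Poincaré's inequality), and let $L^2(V)$ carry its usual norm. Let $B\subset\mathbb{R}^p$ be compact, $B'\supset B$ open in $\mathbb R^p$, and let $H_m:V\times R\to\mathbb{R}$ be kernels such that $(m,x,y)\mapsto H_m(x,y)$ is continuous on $B\times V\times R$ and the partial derivatives $\partial_{m_i}H_m(x,y)$, $1\le i\le p$, exist and are continuous on $B'\times V\times R$. Let $$\mathcal{A}_m:H^1_0(R)\to L^2(V),\qquad \mathcal{A}_m g(x)=\int_R H_m(x,y)g(y)\,d\sigma(y),$$ and let $\partial_q\mathcal{A}_m$ be the operator with kernel $\nabla_mH_m\cdot q$. Assume: * (U1) if $m_1,m_2\in B$, $u,v\in H^1_0(R)$, $\mathcal{A}_{m_1}u=\mathcal{A}_{m_2}v$ and $u\ne0$ or $v\neq0$, then $m_1=m_2$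 and $u=v$; * (U2) if $|q|=1$, $m\in B$, $u,v\in H^1_0(R)$ and $\partial_q\mathcal{A}_mu=\mathcal{A}_mv$, then $u=v=0$. Fix $\beta>0$ with $\|\mathcal{A}_m^*\mathcal{A}_m\|>\beta^2$ for all $m\in B$. Let $E_m$ be the span of the eigenvectors of $\mathcal{A}_m^*\mathcal{A}_m$ with eigenvalue $>\beta^2$, and $\mathcal{P}_m$ the orthogonal projection of $H^1_0(R)$ on $E_m$. Fix $A_1,A_2>0$, let $T_{m}=\{v\in E_{m}: A_1\le\|\mathcal{A}_{m}v\|,\ \|v\|\le A_2\}$, and fix $\tilde m\in B$. Call $W$ *admissible* if $W\subset B$ is a closed convex neighbourhood of $\tilde m$ in $B$ such that $\beta^2$ is not an eigenvalue of $\mathcal{A}_m^*\mathcal{A}_m$ for any $m\in W$, and put $$I(W)=\inf_{|q|=1,\ m,m'\in W}\operatorname{dist}\big((\partial_q\mathcal{A}_m+\mathcal{A}_m\partial_q\mathcal{P}_m)T_{m'},\ \mathcal{A}_mE_m\big)\in[0,\infty],$$ where $\partial_q\mathcal P_m$ is the directional derivative of $m\mapsto\mathcal P_m$ in operator norm, the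 distance to or from the empty set is $\infty$, and $\inf\emptyset=\infty$. Call $C\in[0,\infty]$ a *stability constant for $W$* if $$\|\mathcal{A}_mu-\mathcal{A}_{m'}v\|\ge C\,|m-m'|\qquad\text{for all } m,m'\in W,\ u\in E_m,\ v\in T_{m'}$$ (with $\infty\cdot0=0$). **Proposition.** 1. For every admissible $W$, the map $m\mapsto\mathcal{P}_m$ is continuously differentiable (in operator norm) near every point of $W$, and $I(W)>0$. 2. On small neighbourhoods the stability constant can be taken asymptotically equal to $I(W)$: for every $\varepsilon\in(0,1)$ there is $\delta>0$ such that, for every admissible $W$ contained in the closed ball of radius $\delta$ about $\tilde m$, the number $(1-\varepsilon)I(W)$ is a stability constant for $W$; and if moreover $\tilde m$ is an interior point of $B$, every stability constant $C$ for $W$ satisfies $C\le(1+\varepsilon)I(W)$. -/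

import Mathlib

open MeasureTheory Set Filter Topology
open scoped ENNReal ContDiff

noncomputable section

namespace StabInv

/-- The Euclidean space of dimension `d`. -/
abbrev Euc (d : ℕ) : Type := EuclideanSpace ℝ (Fin d)

section Geometry

variable {d : ℕ}

/-- The coordinate subspace spanned by the first `r` coordinates. -/
def slice (d r : ℕ) : Set (Euc d) := {z | ∀ i : Fin d, r ≤ (i : ℕ) → z i = 0}

/-- The half `{z₀ ≥ 0}` of `slice d r`. -/
def halfSlice (d r : ℕ) : Set (Euc d) :=
  {z | z ∈ slice d r ∧ ∀ i : Fin d, (i : ℕ) = 0 → 0 ≤ z i}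

/-- `Φ` is a bi-Lipschitz homeomorphism between open sets of the ambient space that carries
`R` to the model set `S`. -/
def IsLipChart (R S : Set (Euc d)) (Φ : OpenPartialHomeomorph (Euc d) (Euc d)) : Prop :=
  (∃ K : NNReal, LipschitzOnWith K Φ Φ.source ∧ LipschitzOnWith K Φ.symm Φ.target) ∧
    ∀ x ∈ Φ.source, x ∈ R ↔ Φ x ∈ S

/-- `R` is an `r`-dimensional Lipschitz submanifold with (possibly empty) boundary embedded in
`ℝ^d`: near each of its points it is flattened by a bi-Lipschitz ambient chart to an
`r`-dimensional subspace or half subspace. In particular every embedded `C^1` (or smooth)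
submanifold with boundary is one. -/
def IsSubmanifold (r : ℕ) (R : Set (Euc d)) : Prop :=
  r ≤ d ∧ ∀ x ∈ R, ∃ Φ : OpenPartialHomeomorph (Euc d) (Euc d), x ∈ Φ.source ∧
    (IsLipChart R (slice d r) Φ ∨ IsLipChart R (halfSlice d r) Φ)

/-- The manifold boundary `∂R`: the points of `R` at which there is no chart onto an
`r`-dimensional subspace. -/
def bdry (r : ℕ) (R : Set (Euc d)) : Set (Euc d) :=
  {x | x ∈ R ∧ ¬ ∃ Φ : OpenPartialHomeomorph (Euc d) (Euc d), x ∈ Φ.source ∧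
    IsLipChart R (slice d r) Φ}

/-- The surface measure on `R`: the `r`-dimensional Hausdorff measure, normalised to agree with
Lebesgue measure on `r`-dimensional Euclidean space, restricted to `R`. -/
def surf (r : ℕ) (R : Set (Euc d)) : Measure (Euc d) :=
  (Measure.euclideanHausdorffMeasure r).restrict R

/-- The tangent space of `R` at `y`, the span of the tangent cone. -/
def tangentAt (R : Set (Euc d)) (y : Euc d) : Submodule ℝ (Euc d) :=
  Submodule.span ℝ (tangentConeAt ℝ R y)

/-- The tangential (surface) gradient along `R` of (the restriction to `R` of) an ambient
function. -/
def tangGrad (R : Set (Euc d)) (f : Euc d → ℝ) (y : Euc d) : Euc d :=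
  (tangentAt R y).starProjection (gradient f y)

/-- Test functions: smooth, with compact support disjoint from `∂R`. -/
def IsTest (r : ℕ) (R : Set (Euc d)) (f : Euc d → ℝ) : Prop :=
  ContDiff ℝ ∞ f ∧ HasCompactSupport f ∧ Disjoint (tsupport f) (bdry r R)

/-- `L²(R)`. -/
abbrev L2 (r : ℕ) (R : Set (Euc d)) : Type := Lp ℝ 2 (surf r R)

/-- Square integrable vector fields along `R`. -/
abbrev L2vec (r : ℕ) (R : Set (Euc d)) : Type := Lp (Euc d) 2 (surf r R)

theorem tangGrad_add {R : Set (Euc d)} {f g : Euc d → ℝ} (hf : Differentiable ℝ f)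
    (hg : Differentiable ℝ g) (y : Euc d) :
    tangGrad R (f + g) y = tangGrad R f y + tangGrad R g y := by
  simp only [tangGrad, gradient]
  rw [fderiv_add (hf y) (hg y), map_add, map_add]

theorem tangGrad_smul {R : Set (Euc d)} {f : Euc d → ℝ} (hf : Differentiable ℝ f) (c : ℝ)
    (y : Euc d) : tangGrad R (c • f) y = c • tangGrad R f y := by
  simp only [tangGrad, gradient]
  rw [fderiv_const_smul (hf y), map_smulₛₗ, map_smul]
  simp

theorem tangGrad_zero {R : Set (Euc d)} (y : Euc d) :
    tangGrad R (0 : Euc d → ℝ) y = 0 := by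
  simp [tangGrad, gradient]

/-- The space of pairs `(φ, ∇φ)`, `φ` a test function on `R`. -/
def testGraph (r : ℕ) (R : Set (Euc d)) : Submodule ℝ (L2 r R × L2vec r R) where
  carrier := {w | ∃ f : Euc d → ℝ, IsTest r R f ∧
    (w.1 =ᵐ[surf r R] f) ∧ (w.2 =ᵐ[surf r R] tangGrad R f)}
  zero_mem' := by
    refine ⟨0, ⟨contDiff_const, HasCompactSupport.zero, by simp [tsupport]⟩, ?_, ?_⟩
    · exact Lp.coeFn_zero _ _ _
    · filter_upwards [Lp.coeFn_zero (Euc d) 2 (surf r R)] with y hy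
      rw [tangGrad_zero]
      exact hy
  add_mem' := by
    rintro a b ⟨f, ⟨hf1, hf2, hf3⟩, hfa, hfa'⟩ ⟨g, ⟨hg1, hg2, hg3⟩, hgb, hgb'⟩
    refine ⟨f + g, ⟨hf1.add hg1, hf2.add hg2, ?_⟩, ?_, ?_⟩
    · exact (hf3.union_left hg3).mono_left (tsupport_add f g)
    · filter_upwards [Lp.coeFn_add a.1 b.1, hfa, hgb] with y h1 h2 h3
      rw [Prod.fst_add, h1, Pi.add_apply, Pi.add_apply, h2, h3]
    · filter_upwards [Lp.coeFn_add a.2 b.2, hfa', hgb'] with y h1 h2 h3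
      rw [tangGrad_add (hf1.differentiable (by simp)) (hg1.differentiable (by simp)),
        Prod.snd_add, h1, Pi.add_apply, h2, h3]
  smul_mem' := by
    rintro c a ⟨f, ⟨hf1, hf2, hf3⟩, hfa, hfa'⟩
    refine ⟨c • f, ⟨contDiff_const.smul hf1, ?_, ?_⟩, ?_, ?_⟩
    · exact hf2.smul_left (f := fun _ => c)
    · exact hf3.mono_left (closure_mono (Function.support_const_smul_subset c f))
    · filter_upwards [Lp.coeFn_smul c a.1, hfa] with y h1 h2
      rw [Prod.smul_fst, h1, Pi.smul_apply, Pi.smul_apply, h2]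
    · filter_upwards [Lp.coeFn_smul c a.2, hfa'] with y h1 h2
      rw [tangGrad_smul (hf1.differentiable (by simp)), Prod.smul_snd, h1, Pi.smul_apply, h2]

/-- The closure in `L²` of the gradients of test functions. -/
def gradSpace (r : ℕ) (R : Set (Euc d)) : Submodule ℝ (L2vec r R) :=
  ((testGraph r R).map (LinearMap.snd ℝ (L2 r R) (L2vec r R))).topologicalClosure

/-- The Hilbert space `H¹₀(R)` with inner product `⟪u, v⟫ = ∫_R ∇u · ∇v`, that is, the completion
of the test functions for the Dirichlet norm. The element `u` is represented by its gradient
`∇u`; the function `u` itself is `toL2 r R u`. -/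
abbrev H10 (r : ℕ) (R : Set (Euc d)) : Type := gradSpace r R

instance (r : ℕ) (R : Set (Euc d)) : CompleteSpace (H10 r R) :=
  Submodule.topologicalClosure.completeSpace _

/-- The map `φ ↦ ∇φ` on test functions. -/
def testGrad (r : ℕ) (R : Set (Euc d)) : testGraph r R →ₗ[ℝ] H10 r R :=
  ((LinearMap.snd ℝ (L2 r R) (L2vec r R)).domRestrict (testGraph r R)).codRestrict
    (gradSpace r R)
    (fun w => Submodule.le_topologicalClosure _ (Submodule.mem_map_of_mem w.2))

/-- The embedding `H¹₀(R) → L²(R)`: the continuous extension of `∇φ ↦ φ` from test functions `φ`,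
which exists by Poincaré's inequality when every connected component of the compact manifold `R`
has non-empty boundary. -/
def toL2 (r : ℕ) (R : Set (Euc d)) : H10 r R →L[ℝ] L2 r R :=
  ((LinearMap.fst ℝ (L2 r R) (L2vec r R)).domRestrict (testGraph r R)).extendOfNorm
    (testGrad r R)

open Classical in
/-- The integral operator `g ↦ ∫_R k(·, y) g(y) dσ(y)` from `H¹₀(R)` to `L²(V)`
(it is bounded whenever `k` is continuous on the compact set `V × R`). -/
def intOp (r : ℕ) (R : Set (Euc d)) (s : ℕ) (V : Set (Euc d)) (k : Euc d → Euc d → ℝ) :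
    H10 r R →L[ℝ] L2 s V :=
  if h : ∃ A : H10 r R →L[ℝ] L2 s V, ∀ g : H10 r R,
      A g =ᵐ[surf s V] fun x => ∫ y, k x y * (toL2 r R g) y ∂(surf r R)
  then h.choose else 0

end Geometry

section Kernel

variable {d p : ℕ}

/-- The partial derivative `∂_{m_i} H_m(x, y)` of a kernel with respect to its parameter. -/
def paramDeriv (H : Euc p → Euc d → Euc d → ℝ) (i : Fin p) (m : Euc p) (x y : Euc d) : ℝ :=
  lineDeriv ℝ (fun m' => H m' x y) m (EuclideanSpace.single i 1)

/-- The operator `A_m`. -/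
def opA (r : ℕ) (R : Set (Euc d)) (s : ℕ) (V : Set (Euc d)) (H : Euc p → Euc d → Euc d → ℝ)
    (m : Euc p) : H10 r R →L[ℝ] L2 s V :=
  intOp r R s V (H m)

/-- The operator `∂_q A_m`, with kernel `∇_m H_m · q`. -/
def opDA (r : ℕ) (R : Set (Euc d)) (s : ℕ) (V : Set (Euc d)) (H : Euc p → Euc d → Euc d → ℝ)
    (q m : Euc p) : H10 r R →L[ℝ] L2 s V :=
  intOp r R s V (fun x y => ∑ i, q i * paramDeriv H i m x y)

end Kernel

section Spectral

variable {X Y : Type*} [NormedAddCommGroup X] [InnerProductSpace ℝ X] [CompleteSpace X]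
  [NormedAddCommGroup Y] [InnerProductSpace ℝ Y] [CompleteSpace Y]

/-- `T* T`. -/
def gram (T : X →L[ℝ] Y) : X →L[ℝ] X := (ContinuousLinearMap.adjoint T) ∘L T

/-- `β²` is an eigenvalue of `T* T`. -/
def IsSqEigenvalue (T : X →L[ℝ] Y) (β : ℝ) : Prop :=
  Module.End.HasEigenvalue (gram T : X →ₗ[ℝ] X) (β ^ 2)

/-- The span of the eigenvectors of `T* T` with eigenvalue strictly greater than `β²`. -/
def highSpace (T : X →L[ℝ] Y) (β : ℝ) : Submodule ℝ X :=
  ⨆ μ : {μ : ℝ // β ^ 2 < μ}, Module.End.eigenspace (gram T : X →ₗ[ℝ] X) μ.1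

/-- The orthogonal projection on `highSpace T β` (that space is finite dimensional, hence closed,
if `T` is compact and `β > 0`). -/
def highProj (T : X →L[ℝ] Y) (β : ℝ) : X →L[ℝ] X :=
  (highSpace T β).topologicalClosure.starProjection

/-- `{v ∈ highSpace T β : A₁ ≤ ‖T v‖, ‖v‖ ≤ A₂}`. -/
def truncSet (T : X →L[ℝ] Y) (β A₁ A₂ : ℝ) : Set X :=
  {v | v ∈ highSpace T β ∧ A₁ ≤ ‖T v‖ ∧ ‖v‖ ≤ A₂}

/-- The distance between two sets (`∞` if one of them is empty). -/
def setDist (S T : Set Y) : ℝ≥0∞ := ⨅ x ∈ S, Metric.infEDist x T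

variable {p : ℕ}

/-- The infimum over unit vectors `q` and `m, m' ∈ W` of the distance between
`(∂_q A_m + A_m ∂_q P_m) T_{m'}` and `A_m E_m`; here `dA q m` stands for `∂_q A_m`. -/
def infDist (A : Euc p → X →L[ℝ] Y) (dA : Euc p → Euc p → X →L[ℝ] Y) (β A₁ A₂ : ℝ)
    (W : Set (Euc p)) : ℝ≥0∞ :=
  ⨅ (q : Euc p) (_ : ‖q‖ = 1) (m ∈ W) (m' ∈ W),
    setDist
      ((dA q m + A m ∘L lineDeriv ℝ (fun t => highProj (A t) β) m q) '' truncSet (A m') β A₁ A₂)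
      (A m '' (highSpace (A m) β : Set X))

/-- `‖A_m u - A_{m'} v‖ ≥ C |m - m'|` for all `m, m' ∈ W`, `u ∈ E_m` and all `v ∈ E_{m'}` with
`A₁ ≤ ‖A_{m'} v‖` and `‖v‖ ≤ A₂`. -/
def IsStabilityConst (A : Euc p → X →L[ℝ] Y) (β A₁ A₂ : ℝ) (W : Set (Euc p)) (C : ℝ≥0∞) : Prop :=
  ∀ m ∈ W, ∀ m' ∈ W, ∀ u ∈ highSpace (A m) β, ∀ v ∈ truncSet (A m') β A₁ A₂,
    C * edist m m' ≤ edist (A m u) (A m' v)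

/-- `W` is a closed convex neighbourhood of `m₀` in `B` such that `β²` is not an eigenvalue of
`A_m* A_m` for any `m ∈ W`. -/
def IsGoodNhd (A : Euc p → X →L[ℝ] Y) (β : ℝ) (B : Set (Euc p)) (m₀ : Euc p)
    (W : Set (Euc p)) : Prop :=
  W ⊆ B ∧ W ∈ 𝓝[B] m₀ ∧ IsClosed W ∧ Convex ℝ W ∧ ∀ m ∈ W, ¬ IsSqEigenvalue (A m) β

end Spectral

end StabInv

end

open StabInv

open MeasureTheory Set Filter Topology
open scoped ENNReal ContDiff

noncomputable section

/-! Consider the operator-valued map `F t = A_t P_t`. On `E_m` its derivative in direction `q` is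
`D_m(q) = ∂_q A_m + A_m ∂_q P_m`, the operator inside `I(W)`. For `u ∈ E_m` and `v ∈ T_{m'}` write
`m' - m = κ q` with `κ = |m' - m|`. As `P_{m'} v = v`, `A_{m'} v - A_m u = (F m' - F m) v + A_m (P_m
v - u) = κ (D_m(q) v - A_m w) + o(κ)`, where `w = (u - P_m v) / κ ∈ E_m`. The error is uniform
because `F` is strictly differentiable and `‖v‖ ≤ A₂`, so the left side has norm at least `(I(W) -
o(1)) κ` (`IsRegularAt.exists_lower_bound`). Conversely, moving to `m̃ - t q` and taking `u = P (v +
t w)` there realises any `w ∈ E_{m̃}`, and letting `t → 0` bounds a stability constant by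
`‖D_{m̃}(q) v - A_{m̃} w‖` (`IsRegularAt.stabilityConst_le`). Continuity in the parameter extends
this to all base points near `m̃`. Additive errors become the factors `1 ± ε` because `I(W)` grows
as `W` shrinks and is thus bounded below by a fixed positive constant.

Positivity of `I(W)` (`infDist_pos`) is a compactness argument: a minimising sequence subconverges,
since the spaces `E_m` are finite dimensional and vary continuously, and (U2) forces the limit of
the `v`'s to vanish, contrary to `‖A v‖ ≥ A₁ > 0`.

For the regularity of `P_m` (`contDiffAt_highProj`), let `S = A_m* A_m - β²`, which is invertible.
Then `|S| = S (2P - 1)`, so `P = (1 + S⁻¹ |S|) / 2`, and `|S|` is a `C¹` function of `S²` by the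
inverse function theorem for squaring.

Finally `A_m` is the image of the kernel `H_m ∈ C(V × R)` under a fixed bounded linear map, composed
with `H¹₀ → L²`. Hence it suffices that `m ↦ H_m` be `C¹` in the uniform norm (`contDiffAt_toCont`),
and compactness is that of integral operators with continuous kernel. -/

namespace StabInv

/-! ### Spectral subspaces of `T* T` above the threshold `β²` -/

section Spectrum

open Module.End InnerProductSpace

/-- A vector in a sum of eigenspaces of a symmetric operator is a finite sum of orthogonal
eigenvectors; this expresses its norm and its quadratic form. -/
theorem exists_eigenvector_expansion {X : Type*} [NormedAddCommGroup X]
    [InnerProductSpace ℝ X] {G : X →L[ℝ] X} (hG : (G : X →ₗ[ℝ] X).IsSymmetric)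
    (P : ℝ → Prop) {x : X}
    (hx : x ∈ ⨆ μ : {μ : ℝ // P μ}, eigenspace (G : X →ₗ[ℝ] X) μ.1) :
    ∃ (s : Finset {μ : ℝ // P μ}) (f : {μ : ℝ // P μ} → X),
      ‖x‖ ^ 2 = ∑ i ∈ s, ‖f i‖ ^ 2 ∧ inner ℝ (G x) x = ∑ i ∈ s, i.1 * ‖f i‖ ^ 2 := by
  classical
  obtain ⟨f, hf, rfl⟩ := (Submodule.mem_iSup_iff_exists_finsupp _ _).1 hx
  have horth : ∀ i j, i ≠ j → inner ℝ (f i) (f j) = 0 := fun i j hij =>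
    hG.orthogonalFamily_eigenspaces (i := i.1) (j := j.1) (fun h => hij (Subtype.ext h))
      ⟨f i, hf i⟩ ⟨f j, hf j⟩
  have hGf : ∀ i, G (f i) = i.1 • f i := fun i => mem_eigenspace_iff.1 (hf i)
  refine ⟨f.support, f, ?_, ?_⟩
  · rw [← real_inner_self_eq_norm_sq, Finsupp.sum, sum_inner]
    refine Finset.sum_congr rfl fun i hi => ?_
    rw [inner_sum, Finset.sum_eq_single_of_mem i hi fun j _ hj => horth i j hj.symm,
      real_inner_self_eq_norm_sq]
  · rw [Finsupp.sum, map_sum, sum_inner]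
    refine Finset.sum_congr rfl fun i hi => ?_
    rw [inner_sum, hGf, Finset.sum_eq_single_of_mem i hi fun j _ hj => by
      rw [inner_smul_left, horth i j hj.symm, mul_zero], real_inner_smul_left,
      real_inner_self_eq_norm_sq]

variable {X Y : Type*} [NormedAddCommGroup X] [InnerProductSpace ℝ X] [CompleteSpace X]
  [NormedAddCommGroup Y] [InnerProductSpace ℝ Y] [CompleteSpace Y]

theorem inner_gram_left (T : X →L[ℝ] Y) (x y : X) :
    inner ℝ (gram T x) y = inner ℝ (T x) (T y) := by
  simp [gram, ContinuousLinearMap.adjoint_inner_left]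

theorem gram_isSymmetric (T : X →L[ℝ] Y) : (gram T : X →ₗ[ℝ] X).IsSymmetric := fun x y => by
  change inner ℝ (gram T x) y = inner ℝ x (gram T y)
  rw [inner_gram_left, real_inner_comm (gram T y) x, inner_gram_left, real_inner_comm]

theorem gram_isCompactOperator {T : X →L[ℝ] Y} (hT : IsCompactOperator T) :
    IsCompactOperator (gram T) :=
  hT.clm_comp (ContinuousLinearMap.adjoint T)

theorem le_norm_sq_of_mem_closure_highSpace (T : X →L[ℝ] Y) (β : ℝ) {x : X}
    (hx : x ∈ (highSpace T β).topologicalClosure) : β ^ 2 * ‖x‖ ^ 2 ≤ ‖T x‖ ^ 2 := by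
  have hcl : IsClosed {x : X | β ^ 2 * ‖x‖ ^ 2 ≤ ‖T x‖ ^ 2} :=
    isClosed_le (by fun_prop) (by fun_prop)
  refine closure_minimal (fun y hy => ?_) hcl hx
  obtain ⟨s, f, h1, h2⟩ := exists_eigenvector_expansion (gram_isSymmetric T) (β ^ 2 < ·) hy
  rw [inner_gram_left, real_inner_self_eq_norm_sq] at h2
  rw [mem_ofPred_eq, h1, h2, Finset.mul_sum]
  exact Finset.sum_le_sum fun i _ => mul_le_mul_of_nonneg_right i.2.le (sq_nonneg _)

/-- Compactness enters through the spectral theorem: eigenspaces of `T* T` span a dense subspace, so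
what is orthogonal to those with eigenvalue above `β²` lies in the closure of the sum of the others,
where the quadratic form is at most `β²`. -/
theorem norm_sq_le_of_mem_orthogonal_highSpace {T : X →L[ℝ] Y} (hT : IsCompactOperator T) (β : ℝ)
    {x : X} (hx : x ∈ (highSpace T β)ᗮ) : ‖T x‖ ^ 2 ≤ β ^ 2 * ‖x‖ ^ 2 := by
  set L : Submodule ℝ X := ⨆ μ : {μ : ℝ // μ ≤ β ^ 2}, eigenspace (gram T : X →ₗ[ℝ] X) μ.1
    with hL
  have hLE : L ≤ (highSpace T β)ᗮ := by
    refine iSup_le fun μ => ?_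
    rw [highSpace, ← Submodule.iInf_orthogonal]
    refine le_iInf fun ν y hy z hz => ?_
    exact (gram_isSymmetric T).orthogonalFamily_eigenspaces (i := ν.1) (j := μ.1)
      (fun h => absurd ν.2 (by rw [h]; exact not_lt.2 μ.2)) ⟨z, hz⟩ ⟨y, hy⟩
  have htop : (highSpace T β)ᗮ ⊓ L.topologicalClosureᗮ = ⊥ := by
    rw [eq_bot_iff, ← ContinuousLinearMap.orthogonalComplement_iSup_eigenspaces_eq_bot
      (gram_isCompactOperator hT) (gram_isSymmetric T), Submodule.orthogonal_closure,
      Submodule.inf_orthogonal]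
    refine Submodule.orthogonal_le (iSup_le fun μ => ?_)
    rcases lt_or_ge (β ^ 2) μ with h | h
    · exact le_trans (le_iSup (fun μ : {μ : ℝ // β ^ 2 < μ} =>
        eigenspace (gram T : X →ₗ[ℝ] X) μ.1) ⟨μ, h⟩) le_sup_left
    · exact le_trans (le_iSup (fun μ : {μ : ℝ // μ ≤ β ^ 2} =>
        eigenspace (gram T : X →ₗ[ℝ] X) μ.1) ⟨μ, h⟩) le_sup_right
  have : CompleteSpace L.topologicalClosure := Submodule.topologicalClosure.completeSpace _
  have hxL : x ∈ L.topologicalClosure := by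
    have h1 : x - L.topologicalClosure.starProjection x ∈ L.topologicalClosureᗮ :=
      Submodule.sub_starProjection_mem_orthogonal x
    have h2 : L.topologicalClosure.starProjection x ∈ (highSpace T β)ᗮ :=
      Submodule.topologicalClosure_minimal _ hLE (Submodule.isClosed_orthogonal _)
        (Submodule.starProjection_apply_mem _ x)
    have h3 : x - L.topologicalClosure.starProjection x = 0 := by
      rw [← Submodule.mem_bot ℝ, ← htop]
      exact ⟨Submodule.sub_mem _ hx h2, h1⟩
    rw [sub_eq_zero.1 h3]
    exact Submodule.starProjection_apply_mem _ x
  have hcl : IsClosed {x : X | ‖T x‖ ^ 2 ≤ β ^ 2 * ‖x‖ ^ 2} :=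
    isClosed_le (by fun_prop) (by fun_prop)
  refine closure_minimal (fun y hy => ?_) hcl hxL
  obtain ⟨s, f, h1, h2⟩ := exists_eigenvector_expansion (gram_isSymmetric T) (· ≤ β ^ 2) hy
  rw [inner_gram_left, real_inner_self_eq_norm_sq] at h2
  rw [mem_ofPred_eq, h1, h2, Finset.mul_sum]
  exact Finset.sum_le_sum fun i _ => mul_le_mul_of_nonneg_right i.2 (sq_nonneg _)

theorem gram_mem_closure_highSpace (T : X →L[ℝ] Y) (β : ℝ) {x : X}
    (hx : x ∈ (highSpace T β).topologicalClosure) :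
    gram T x ∈ (highSpace T β).topologicalClosure := by
  have h : highSpace T β ≤ (highSpace T β).comap (gram T : X →ₗ[ℝ] X) := by
    refine iSup_le fun μ y hy => ?_
    rw [Submodule.mem_comap, mem_eigenspace_iff.1 hy]
    exact Submodule.smul_mem _ _ (Submodule.mem_iSup_of_mem (p := fun μ : {μ : ℝ // β ^ 2 < μ} =>
        eigenspace (gram T : X →ₗ[ℝ] X) μ.1) μ hy)
  exact map_mem_closure (gram T).continuous hx fun y hy => h hy

instance instCompleteSpaceClosureHighSpace (T : X →L[ℝ] Y) (β : ℝ) :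
    CompleteSpace (highSpace T β).topologicalClosure :=
  Submodule.topologicalClosure.completeSpace _

theorem highProj_isSelfAdjoint (T : X →L[ℝ] Y) (β : ℝ) : IsSelfAdjoint (highProj T β) :=
  isSelfAdjoint_starProjection _

theorem highProj_mul_self (T : X →L[ℝ] Y) (β : ℝ) : highProj T β * highProj T β = highProj T β :=
  Submodule.isIdempotentElem_starProjection _

theorem highProj_apply_mem (T : X →L[ℝ] Y) (β : ℝ) (x : X) :
    highProj T β x ∈ (highSpace T β).topologicalClosure :=
  Submodule.starProjection_apply_mem _ x

theorem highProj_eq_self (T : X →L[ℝ] Y) (β : ℝ) {x : X}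
    (hx : x ∈ (highSpace T β).topologicalClosure) : highProj T β x = x :=
  Submodule.starProjection_eq_self_iff.2 hx

theorem sub_highProj_mem_orthogonal (T : X →L[ℝ] Y) (β : ℝ) (x : X) :
    x - highProj T β x ∈ (highSpace T β)ᗮ := by
  rw [← Submodule.orthogonal_closure]
  exact Submodule.sub_starProjection_mem_orthogonal x

theorem norm_highProj_apply_le (T : X →L[ℝ] Y) (β : ℝ) (x : X) : ‖highProj T β x‖ ≤ ‖x‖ :=
  Submodule.norm_starProjection_apply_le _ x

/-- Invariance of the range gives `G P = P G P`; the right side is self-adjoint, so taking adjoints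
gives `P G = P G P` as well. -/
theorem commute_gram_highProj (T : X →L[ℝ] Y) (β : ℝ) : Commute (gram T) (highProj T β) := by
  have h : gram T * highProj T β = highProj T β * (gram T * highProj T β) := by
    ext x
    exact (highProj_eq_self T β
      (gram_mem_closure_highSpace T β (highProj_apply_mem T β x))).symm
  have hs : star (gram T) = gram T := (gram_isSymmetric T).isSelfAdjoint
  have hp : star (highProj T β) = highProj T β := highProj_isSelfAdjoint T β
  have h' := congrArg star h
  simp only [star_mul, hs, hp] at h'
  rw [Commute, SemiconjBy, h, h', mul_assoc]

/-- `T` is bounded below by `β` on `highSpace T β`. -/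
theorem mul_norm_le_of_mem_highSpace (T : X →L[ℝ] Y) {β : ℝ} (hβ : 0 < β) {x : X}
    (hx : x ∈ (highSpace T β).topologicalClosure) : β * ‖x‖ ≤ ‖T x‖ := by
  have := le_norm_sq_of_mem_closure_highSpace T β hx
  rw [← mul_pow] at this
  exact (pow_le_pow_iff_left₀ (by positivity) (by positivity) two_ne_zero).1 this

/-- Restricted to this invariant space, `T* T` is compact and also coercive, hence invertible; so
the identity is compact. -/
theorem finiteDimensional_highSpace {T : X →L[ℝ] Y} (hT : IsCompactOperator T) {β : ℝ}
    (hβ : 0 < β) : FiniteDimensional ℝ (highSpace T β).topologicalClosure := by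
  set E := (highSpace T β).topologicalClosure with hE
  let S : E →L[ℝ] E := (gram T).restrict fun x hx => gram_mem_closure_highSpace T β hx
  have hS : IsCompactOperator S :=
    (gram_isCompactOperator hT).restrict' fun x hx => gram_mem_closure_highSpace T β hx
  have hu : IsUnit S := by
    refine ContinuousLinearMap.isUnit_of_forall_le_norm_inner_map S (c := ⟨β ^ 2, sq_nonneg β⟩)
      (by exact_mod_cast sq_pos_of_pos hβ) fun x => ?_
    have h := le_norm_sq_of_mem_closure_highSpace T β x.2
    have h2 : inner ℝ (S x) x = ‖T (x : X)‖ ^ 2 := by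
      rw [← real_inner_self_eq_norm_sq, ← inner_gram_left]
      rfl
    rw [h2, Real.norm_of_nonneg (sq_nonneg _)]
    exact (mul_comm _ _).trans_le h
  obtain ⟨u, hu⟩ := hu
  apply FiniteDimensional.of_isCompactOperator_id (𝕜 := ℝ)
  have hcomp := hS.clm_comp (↑u⁻¹ : E →L[ℝ] E)
  have hid : (⇑(↑u⁻¹ : E →L[ℝ] E) ∘ ⇑S) = id := by
    funext x
    have : ((↑u⁻¹ : E →L[ℝ] E) * S) x = x := by rw [← hu]; simp
    exact this
  rwa [hid] at hcomp

theorem closure_highSpace {T : X →L[ℝ] Y} (hT : IsCompactOperator T) {β : ℝ} (hβ : 0 < β) :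
    (highSpace T β).topologicalClosure = highSpace T β := by
  have := finiteDimensional_highSpace hT hβ
  have : FiniteDimensional ℝ (highSpace T β) :=
    Submodule.finiteDimensional_of_le (Submodule.le_topologicalClosure _)
  exact (Submodule.closed_of_finiteDimensional _).submodule_topologicalClosure_eq

end Spectrum

/-! ### Square roots in Banach algebras -/

/-- Local smooth square roots in a real Banach algebra, near an element that is close to a
positive scalar. -/
theorem exists_contDiffAt_sqrt {𝔸 : Type*} [NormedRing 𝔸] [NormedAlgebra ℝ 𝔸] [CompleteSpace 𝔸]
    {a : 𝔸} {l : ℝ} (hl : 0 < l) (ha : ‖algebraMap ℝ 𝔸 l - a‖ < l) :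
    ∃ g : 𝔸 → 𝔸, ContDiffAt ℝ 1 g (a * a) ∧ g (a * a) = a ∧
      ∀ᶠ y in 𝓝 (a * a), g y * g y = y := by
  -- `M` is the derivative of `y ↦ y * y` at `a`. At the scalar `l` it would be `2 * l`, and the
  -- hypothesis on `a` keeps `M / (2 * l)` within distance less than `1` of the identity, so a
  -- Neumann series inverts it.
  set M : 𝔸 →L[ℝ] 𝔸 := ContinuousLinearMap.mul ℝ 𝔸 a + (ContinuousLinearMap.mul ℝ 𝔸).flip a
    with hM
  have hMa : ∀ y, M y = a * y + y * a := fun y => by simp [hM]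
  set t : 𝔸 →L[ℝ] 𝔸 := 1 - (2 * l)⁻¹ • M with ht
  have ht1 : ‖t‖ < 1 := by
    refine lt_of_le_of_lt (ContinuousLinearMap.opNorm_le_bound _
      (div_nonneg (norm_nonneg (algebraMap ℝ 𝔸 l - a)) hl.le) fun y => ?_)
      ((div_lt_one hl).2 ha)
    have hty : t y = (2 * l)⁻¹ • ((algebraMap ℝ 𝔸 l - a) * y + y * (algebraMap ℝ 𝔸 l - a)) := by
      have h2 : (2 * l)⁻¹ • ((2 * l) • y) = y := inv_smul_smul₀ (by positivity) y
      have h3 : (algebraMap ℝ 𝔸 l - a) * y + y * (algebraMap ℝ 𝔸 l - a) = (2 * l) • y - M y := by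
        rw [hMa, sub_mul, mul_sub, ← Algebra.commutes, ← Algebra.smul_def, two_mul, add_smul]
        abel
      rw [h3, smul_sub, h2]
      simp [ht]
    rw [hty, norm_smul, Real.norm_of_nonneg (by positivity)]
    calc (2 * l)⁻¹ * ‖(algebraMap ℝ 𝔸 l - a) * y + y * (algebraMap ℝ 𝔸 l - a)‖
        ≤ (2 * l)⁻¹ * (‖algebraMap ℝ 𝔸 l - a‖ * ‖y‖ + ‖y‖ * ‖algebraMap ℝ 𝔸 l - a‖) := by
          gcongr
          exact (norm_add_le _ _).trans (add_le_add (norm_mul_le _ _) (norm_mul_le _ _))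
      _ = ‖algebraMap ℝ 𝔸 l - a‖ / l * ‖y‖ := by field_simp; ring
  have hunit : IsUnit M := by
    have h1 : IsUnit (1 - t) := (Units.oneSub t ht1).isUnit
    have h2 : M = (2 * l) • (1 - t) := by
      rw [ht, sub_sub_cancel, smul_inv_smul₀ (by positivity)]
    have h3 : M = algebraMap ℝ (𝔸 →L[ℝ] 𝔸) (2 * l) * (1 - t) := by
      rw [h2]
      ext y
      simp [Algebra.algebraMap_eq_smul_one]
    rw [h3]
    exact ((IsUnit.mk0 (2 * l) (by positivity)).map (algebraMap ℝ (𝔸 →L[ℝ] 𝔸))).mul h1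
  obtain ⟨u, hu⟩ := hunit
  set e : 𝔸 ≃L[ℝ] 𝔸 := ContinuousLinearEquiv.ofUnit u with he
  have hf : ContDiffAt ℝ 1 (fun y : 𝔸 => y * y) a := contDiffAt_id.mul contDiffAt_id
  have hf' : HasFDerivAt (fun y : 𝔸 => y * y) (e : 𝔸 →L[ℝ] 𝔸) a := by
    have h := (hasFDerivAt_id (𝕜 := ℝ) a).mul' (hasFDerivAt_id (𝕜 := ℝ) a)
    refine h.congr_fderiv (ContinuousLinearMap.ext fun y => Eq.symm ?_)
    change (u : 𝔸 →L[ℝ] 𝔸) y = _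
    rw [hu, hMa]
    simp
  refine ⟨hf.localInverse hf' one_ne_zero, hf.to_localInverse hf' one_ne_zero,
    hf.localInverse_apply_image hf' one_ne_zero, ?_⟩
  exact (hf.hasStrictFDerivAt' hf' one_ne_zero).eventually_right_inverse

/-- Square roots close to a positive scalar are unique. -/
theorem eq_of_mul_self_eq_mul_self {𝔸 : Type*} [NormedRing 𝔸] [NormedAlgebra ℝ 𝔸] {a b : 𝔸} {l : ℝ}
    (ha : ‖algebraMap ℝ 𝔸 l - a‖ < l) (hb : ‖algebraMap ℝ 𝔸 l - b‖ ≤ l) (hab : a * a = b * b) :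
    a = b := by
  have hl : 0 < l := (norm_nonneg _).trans_lt ha
  by_contra hne
  have hD : 0 < ‖a - b‖ := norm_pos_iff.2 (sub_ne_zero.2 hne)
  -- This is a rewriting of `a * (a - b) + (a - b) * b = a * a - b * b = 0`. One strict inequality
  -- among the two hypotheses then suffices to force `a = b`.
  have h : (2 * l) • (a - b)
      = (algebraMap ℝ 𝔸 l - a) * (a - b) + (a - b) * (algebraMap ℝ 𝔸 l - b) := by
    have h0 : a * (a - b) + (a - b) * b = 0 := by
      rw [mul_sub, sub_mul, hab]; abel
    rw [sub_mul, mul_sub (a - b), ← Algebra.commutes, ← Algebra.smul_def, two_mul, add_smul,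
      ← sub_eq_zero]
    calc _ = a * (a - b) + (a - b) * b := by abel
      _ = 0 := h0
  have h2 : 2 * l * ‖a - b‖ ≤ ‖algebraMap ℝ 𝔸 l - a‖ * ‖a - b‖ + ‖a - b‖ * l := by
    calc 2 * l * ‖a - b‖ = ‖(2 * l) • (a - b)‖ := by
          rw [norm_smul, Real.norm_of_nonneg (by positivity)]
      _ ≤ ‖algebraMap ℝ 𝔸 l - a‖ * ‖a - b‖ + ‖a - b‖ * ‖algebraMap ℝ 𝔸 l - b‖ := by
          rw [h]
          exact (norm_add_le _ _).trans (add_le_add (norm_mul_le _ _) (norm_mul_le _ _))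
      _ ≤ _ := by gcongr
  nlinarith

/-! ### Smooth dependence of the spectral projection -/

section Hilbert

variable {X Y : Type*} [NormedAddCommGroup X] [InnerProductSpace ℝ X] [CompleteSpace X]
  [NormedAddCommGroup Y] [InnerProductSpace ℝ Y] [CompleteSpace Y]

/-- The norm of a self-adjoint operator is the supremum of its Rayleigh quotients in absolute value,
and those of `l - S` lie between `0` and `l - c`. -/
theorem norm_algebraMap_sub_le {S : X →L[ℝ] X} (hS : IsSelfAdjoint S) {c l : ℝ}
    (hc : ∀ z, c * ‖z‖ ^ 2 ≤ inner ℝ (S z) z) (hl : ∀ z, inner ℝ (S z) z ≤ l * ‖z‖ ^ 2)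
    (hcl : c ≤ l) : ‖algebraMap ℝ (X →L[ℝ] X) l - S‖ ≤ l - c := by
  have hsa : IsSelfAdjoint (algebraMap ℝ (X →L[ℝ] X) l - S) :=
    (IsSelfAdjoint.algebraMap _ (IsSelfAdjoint.all l)).sub hS
  have hz : ∀ z, (algebraMap ℝ (X →L[ℝ] X) l - S) z = l • z - S z := fun z => by
    simp [Algebra.algebraMap_eq_smul_one]
  rw [ContinuousLinearMap.norm_eq_iSup_rayleighQuotient _ hsa.isSymmetric]
  refine Real.iSup_le (fun z => ?_) (sub_nonneg.2 hcl)
  rw [ContinuousLinearMap.rayleighQuotient, ContinuousLinearMap.reApplyInnerSelf_apply, hz,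
    inner_sub_left, real_inner_smul_left, real_inner_self_eq_norm_sq]
  simp only [RCLike.re_to_real]
  rcases eq_or_ne z 0 with rfl | hz0
  · simpa using hcl
  · have hpos : 0 < ‖z‖ ^ 2 := by positivity
    rw [abs_le]
    constructor
    · rw [le_div_iff₀ hpos]
      nlinarith [hl z, mul_nonneg (sub_nonneg.2 hcl) hpos.le]
    · rw [div_le_iff₀ hpos]
      nlinarith [hc z]

/-- A nonnegative invertible operator is coercive. -/
theorem exists_coercive_of_isUnit {S : X →L[ℝ] X} (hS : IsSelfAdjoint S)
    (h0 : ∀ z, 0 ≤ inner ℝ (S z) z) (hu : IsUnit S) :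
    ∃ c : ℝ, 0 < c ∧ ∀ z, c * ‖z‖ ^ 2 ≤ inner ℝ (S z) z := by
  obtain ⟨u, rfl⟩ := hu
  set S : X →L[ℝ] X := ↑u
  set l : ℝ := ‖S‖ + 1 with hl
  have hl0 : 0 < l := by positivity
  set k : ℝ := ‖(↑u⁻¹ : X →L[ℝ] X)‖ + 1 with hk
  have hk0 : 0 < k := by positivity
  have hup : ∀ z, inner ℝ (S z) z ≤ l * ‖z‖ ^ 2 := fun z => by
    calc inner ℝ (S z) z ≤ ‖S z‖ * ‖z‖ := real_inner_le_norm _ _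
      _ ≤ (‖S‖ * ‖z‖) * ‖z‖ := by gcongr; exact S.le_opNorm z
      _ ≤ l * ‖z‖ ^ 2 := by rw [hl]; nlinarith [sq_nonneg ‖z‖]
  have hn := norm_algebraMap_sub_le (c := 0) (l := l) hS (by simpa using h0) hup hl0.le
  -- Expanding `‖l z - S z‖ ≤ l ‖z‖` gives `‖S z‖² ≤ 2 l ⟪S z, z⟫`, while the inverse gives `‖z‖ ≤ k
  -- ‖S z‖`; the constant combines the two.
  refine ⟨(2 * l * k ^ 2)⁻¹, by positivity, fun z => ?_⟩
  have h1 : ‖l • z - S z‖ ^ 2 ≤ (l * ‖z‖) ^ 2 := by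
    have := (ContinuousLinearMap.le_of_opNorm_le _ hn z)
    rw [sub_zero] at this
    have hz : (algebraMap ℝ (X →L[ℝ] X) l - S) z = l • z - S z := by
      simp [Algebra.algebraMap_eq_smul_one]
    rw [hz] at this
    gcongr
  have h2 : ‖z‖ ≤ k * ‖S z‖ := by
    have h3 : z = (↑u⁻¹ : X →L[ℝ] X) (S z) := by
      have : ((↑u⁻¹ : X →L[ℝ] X) * S) z = z := by simp [S]
      exact this.symm
    calc ‖z‖ = ‖(↑u⁻¹ : X →L[ℝ] X) (S z)‖ := by rw [← h3]
      _ ≤ ‖(↑u⁻¹ : X →L[ℝ] X)‖ * ‖S z‖ := ContinuousLinearMap.le_opNorm _ _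
      _ ≤ k * ‖S z‖ := by gcongr; rw [hk]; linarith
  rw [norm_sub_sq_real, norm_smul, Real.norm_of_nonneg hl0.le, real_inner_smul_left,
    real_inner_comm] at h1
  have h4 : ‖z‖ ^ 2 ≤ k ^ 2 * ‖S z‖ ^ 2 := by rw [← mul_pow]; gcongr
  rw [inv_mul_le_iff₀ (by positivity)]
  nlinarith [mul_le_mul_of_nonneg_left (show ‖S z‖ ^ 2 ≤ 2 * l * inner ℝ (S z) z by linarith)
    (sq_nonneg k)]

/-- `T* T - β²`. -/
def gramShift (T : X →L[ℝ] Y) (β : ℝ) : X →L[ℝ] X := gram T - algebraMap ℝ (X →L[ℝ] X) (β ^ 2)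

/-- `|T* T - β²|`. -/
def gramAbs (T : X →L[ℝ] Y) (β : ℝ) : X →L[ℝ] X := gramShift T β * (2 * highProj T β - 1)

theorem gramShift_isSelfAdjoint (T : X →L[ℝ] Y) (β : ℝ) : IsSelfAdjoint (gramShift T β) :=
  ((gram_isSymmetric T).isSelfAdjoint).sub (IsSelfAdjoint.algebraMap _ (IsSelfAdjoint.all _))

theorem inner_gramShift (T : X →L[ℝ] Y) (β : ℝ) (x : X) :
    inner ℝ (gramShift T β x) x = ‖T x‖ ^ 2 - β ^ 2 * ‖x‖ ^ 2 := by
  have : gramShift T β x = gram T x - β ^ 2 • x := by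
    simp [gramShift, Algebra.algebraMap_eq_smul_one]
  rw [this, inner_sub_left, inner_gram_left, real_inner_smul_left, real_inner_self_eq_norm_sq,
    real_inner_self_eq_norm_sq]

theorem reflection_mul_self (T : X →L[ℝ] Y) (β : ℝ) :
    (2 * highProj T β - 1) * (2 * highProj T β - 1) = 1 := by
  have h := highProj_mul_self T β
  calc (2 * highProj T β - 1) * (2 * highProj T β - 1)
      = 4 * (highProj T β * highProj T β) - 4 * highProj T β + 1 := by noncomm_ring
    _ = 1 := by rw [h]; abel

theorem commute_gramShift_reflection (T : X →L[ℝ] Y) (β : ℝ) :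
    Commute (gramShift T β) (2 * highProj T β - 1) := by
  have h : Commute (gramShift T β) (highProj T β) :=
    (commute_gram_highProj T β).sub_left (Algebra.commutes _ _)
  rw [two_mul]
  exact (h.add_right h).sub_right (Commute.one_right _)

theorem gramAbs_mul_self (T : X →L[ℝ] Y) (β : ℝ) :
    gramAbs T β * gramAbs T β = gramShift T β * gramShift T β := by
  have h := (commute_gramShift_reflection T β).eq
  calc gramAbs T β * gramAbs T β
      = gramShift T β * ((2 * highProj T β - 1) * gramShift T β) * (2 * highProj T β - 1) := by
        simp only [gramAbs, mul_assoc]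
    _ = gramShift T β * gramShift T β * ((2 * highProj T β - 1) * (2 * highProj T β - 1)) := by
        rw [← h]; simp only [mul_assoc]
    _ = _ := by rw [reflection_mul_self, mul_one]

theorem reflection_isSelfAdjoint (T : X →L[ℝ] Y) (β : ℝ) :
    IsSelfAdjoint (2 * highProj T β - 1) := by
  rw [two_mul]
  exact ((highProj_isSelfAdjoint T β).add (highProj_isSelfAdjoint T β)).sub (IsSelfAdjoint.one _)

theorem gramAbs_isSelfAdjoint (T : X →L[ℝ] Y) (β : ℝ) : IsSelfAdjoint (gramAbs T β) :=
  ((gramShift_isSelfAdjoint T β).commute_iff (reflection_isSelfAdjoint T β)).1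
    (commute_gramShift_reflection T β)

/-- Split `z = e + f` along the projection. Then `|S| z = S e - S f`, the cross terms cancel by
symmetry, and the form of `S` is nonnegative on the high space and nonpositive on its complement. -/
theorem inner_gramAbs_nonneg {T : X →L[ℝ] Y} (hT : IsCompactOperator T) (β : ℝ) (z : X) :
    0 ≤ inner ℝ (gramAbs T β z) z := by
  set e := highProj T β z with he
  set f := z - e with hf
  have h1 : gramAbs T β z = gramShift T β e - gramShift T β f := by
    rw [← map_sub, hf]
    change gramShift T β ((2 * highProj T β - 1 : X →L[ℝ] X) z) = _
    congr 1
    rw [two_mul]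
    change e + e - z = _
    abel
  have hz : z = e + f := by rw [hf]; abel
  have hsym : inner ℝ (gramShift T β e) f = inner ℝ (gramShift T β f) e := by
    rw [real_inner_comm (gramShift T β e) f |>.symm]
    exact ((gramShift_isSelfAdjoint T β).isSymmetric f e).symm
  have h2 : inner ℝ (gramAbs T β z) z
      = inner ℝ (gramShift T β e) e - inner ℝ (gramShift T β f) f := by
    have h3 : inner ℝ (gramAbs T β z) z = inner ℝ (gramAbs T β z) (e + f) := by rw [← hz]
    rw [h3, h1, inner_sub_left, inner_add_right, inner_add_right, hsym]
    ring
  rw [h2, inner_gramShift, inner_gramShift]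
  have h3 := le_norm_sq_of_mem_closure_highSpace T β (highProj_apply_mem T β z)
  have h4 := norm_sq_le_of_mem_orthogonal_highSpace hT β (sub_highProj_mem_orthogonal T β z)
  linarith

theorem norm_gramAbs_apply_le (T : X →L[ℝ] Y) (β : ℝ) (z : X) :
    ‖gramAbs T β z‖ ≤ ‖gramShift T β‖ * ‖z‖ := by
  have h : ‖(2 * highProj T β - 1 : X →L[ℝ] X) z‖ = ‖z‖ := by
    have := reflection_mul_self T β
    rw [← sq_eq_sq₀ (norm_nonneg _) (norm_nonneg _), ← real_inner_self_eq_norm_sq,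
      ← real_inner_self_eq_norm_sq]
    calc _ = inner ℝ (((2 * highProj T β - 1) * (2 * highProj T β - 1) : X →L[ℝ] X) z) z :=
          ((reflection_isSelfAdjoint T β).isSymmetric _ _).symm
      _ = _ := by rw [this]; rfl
  calc ‖gramAbs T β z‖ = ‖gramShift T β ((2 * highProj T β - 1 : X →L[ℝ] X) z)‖ := rfl
    _ ≤ _ := by rw [← h]; exact ContinuousLinearMap.le_opNorm _ _

/-- Fredholm alternative: a nonzero number that is not an eigenvalue of a compact operator is in its
resolvent set. -/
theorem isUnit_gramShift {T : X →L[ℝ] Y} (hT : IsCompactOperator T) {β : ℝ} (hβ : β ≠ 0)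
    (h : ¬ IsSqEigenvalue T β) : IsUnit (gramShift T β) := by
  rcases (gram_isCompactOperator hT).hasEigenvalue_or_mem_resolventSet (pow_ne_zero 2 hβ) with h1 | h1
  · exact absurd h1 h
  · have := (spectrum.mem_resolventSet_iff.1 h1).neg
    rwa [neg_sub] at this

theorem isUnit_gramAbs {T : X →L[ℝ] Y} {β : ℝ} (h : IsUnit (gramShift T β)) :
    IsUnit (gramAbs T β) :=
  h.mul ⟨⟨_, _, reflection_mul_self T β, reflection_mul_self T β⟩, rfl⟩

theorem contDiff_gram : ContDiff ℝ 1 (gram : (X →L[ℝ] Y) → X →L[ℝ] X) := by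
  have h : IsBoundedLinearMap ℝ
      (fun T : X →L[ℝ] Y => (ContinuousLinearMap.adjoint T : Y →L[ℝ] X)) :=
    ⟨⟨fun _ _ => map_add _ _ _, fun c T => by simp⟩, 1, one_pos, fun T => by simp⟩
  exact h.contDiff.clm_comp contDiff_id

/-- The spectral projections of a `C¹` family of compact operators are `C¹` where `β²` is not an
eigenvalue. -/
theorem contDiffAt_highProj {E : Type*} [NormedAddCommGroup E] [NormedSpace ℝ E]
    {A : E → X →L[ℝ] Y} {m : E} {β : ℝ} (hβ : β ≠ 0) (hA : ContDiffAt ℝ 1 A m)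
    (hcpt : ∀ᶠ t in 𝓝 m, IsCompactOperator (A t)) (hm : ¬ IsSqEigenvalue (A m) β) :
    ContDiffAt ℝ 1 (fun t => highProj (A t) β) m := by
  have hG : ContDiffAt ℝ 1 (fun t => gramShift (A t) β) m :=
    (contDiff_gram.contDiffAt.comp m hA).sub contDiffAt_const
  have hGu : IsUnit (gramShift (A m) β) := isUnit_gramShift hcpt.self_of_nhds hβ hm
  obtain ⟨c, hc, hcoer⟩ := exists_coercive_of_isUnit (gramAbs_isSelfAdjoint (A m) β)
    (inner_gramAbs_nonneg hcpt.self_of_nhds β) (isUnit_gramAbs hGu)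
  -- The `+ 1` leaves room for `‖S_t‖ ≤ l` to persist near `m`; the maximum with `c` secures `c ≤
  -- l`.
  set l : ℝ := max (‖gramShift (A m) β‖ + 1) c with hl
  have hl0 : 0 < l := hc.trans_le (le_max_right _ _)
  have hup : ∀ t, ‖gramShift (A t) β‖ ≤ l → ∀ z, inner ℝ (gramAbs (A t) β z) z ≤ l * ‖z‖ ^ 2 := by
    intro t ht z
    calc inner ℝ (gramAbs (A t) β z) z ≤ ‖gramAbs (A t) β z‖ * ‖z‖ := real_inner_le_norm _ _
      _ ≤ (l * ‖z‖) * ‖z‖ := by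
        gcongr
        exact (norm_gramAbs_apply_le _ _ _).trans (by gcongr)
      _ = _ := by ring
  have hlm : ‖gramShift (A m) β‖ ≤ l := by linarith [le_max_left (‖gramShift (A m) β‖ + 1) c]
  have hm0 : ‖algebraMap ℝ (X →L[ℝ] X) l - gramAbs (A m) β‖ < l :=
    (norm_algebraMap_sub_le (gramAbs_isSelfAdjoint _ _) hcoer (hup m hlm)
      (le_max_right _ _)).trans_lt (by linarith)
  obtain ⟨g, hg, hga, hgs⟩ := exists_contDiffAt_sqrt hl0 hm0
  rw [gramAbs_mul_self] at hg hga hgs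
  have hX : ContDiffAt ℝ 1 (fun t => g (gramShift (A t) β * gramShift (A t) β)) m :=
    ContDiffAt.comp m hg (hG.mul hG)
  have hcont : ContinuousAt (fun t => ‖gramShift (A t) β‖) m := hG.continuousAt.norm
  have h1 : ∀ᶠ t in 𝓝 m, ‖gramShift (A t) β‖ < l :=
    hcont.eventually_lt_const (by linarith [le_max_left (‖gramShift (A m) β‖ + 1) c])
  have h2 : ∀ᶠ t in 𝓝 m,
      ‖algebraMap ℝ (X →L[ℝ] X) l - g (gramShift (A t) β * gramShift (A t) β)‖ < l := by
    refine Tendsto.eventually_lt_const ?_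
      (continuousAt_const.sub hX.continuousAt).norm.tendsto
    change ‖algebraMap ℝ (X →L[ℝ] X) l - g (gramShift (A m) β * gramShift (A m) β)‖ < l
    rwa [hga]
  have h3 : ∀ᶠ t in 𝓝 m, g (gramShift (A t) β * gramShift (A t) β)
      * g (gramShift (A t) β * gramShift (A t) β) = gramShift (A t) β * gramShift (A t) β :=
    (hG.continuousAt.mul hG.continuousAt).eventually hgs
  have h4 : ∀ᶠ t in 𝓝 m, IsUnit (gramShift (A t) β) :=
    hG.continuousAt.eventually (Units.isOpen.mem_nhds hGu)
  obtain ⟨u, hu⟩ := hGu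
  have hinv : ContDiffAt ℝ 1 (fun t => Ring.inverse (gramShift (A t) β)) m := by
    have := contDiffAt_ringInverse (n := 1) ℝ u
    rw [hu] at this
    exact this.comp m hG
  -- The formula `P = (1 + S⁻¹ |S|) / 2`, with the local root `g (S²)` in place of `|S|`.
  refine ContDiffAt.congr_of_eventuallyEq (f := fun t => (2⁻¹ : ℝ) •
    (1 + Ring.inverse (gramShift (A t) β) * g (gramShift (A t) β * gramShift (A t) β)))
    ((contDiffAt_const.add (hinv.mul hX)).const_smul _) ?_
  filter_upwards [h1, h2, h3, h4, hcpt] with t k1 k2 k3 k4 k5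
  -- Away from `m` only nonnegativity of `|S_t|` is used, without uniform coercivity: uniqueness of
  -- roots asks for the strict bound on `g (S²)` alone.
  have hY : ‖algebraMap ℝ (X →L[ℝ] X) l - gramAbs (A t) β‖ ≤ l := by
    have := norm_algebraMap_sub_le (c := 0) (gramAbs_isSelfAdjoint (A t) β)
      (by simpa using inner_gramAbs_nonneg k5 β) (hup t k1.le) hl0.le
    rwa [sub_zero] at this
  have key : g (gramShift (A t) β * gramShift (A t) β) = gramAbs (A t) β :=
    eq_of_mul_self_eq_mul_self k2 hY (by rw [k3, gramAbs_mul_self])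
  rw [key, gramAbs, ← mul_assoc, Ring.inverse_mul_cancel _ k4, one_mul, add_sub_cancel, two_mul,
    ← two_smul ℝ, inv_smul_smul₀ two_ne_zero]

end Hilbert

theorem tendsto_clm_apply {ι E F : Type*} [NormedAddCommGroup E] [NormedSpace ℝ E]
    [NormedAddCommGroup F] [NormedSpace ℝ F] {l : Filter ι} {f : ι → E →L[ℝ] F} {x : ι → E}
    {f₀ : E →L[ℝ] F} {x₀ : E} (hf : Tendsto f l (𝓝 f₀)) (hx : Tendsto x l (𝓝 x₀)) :
    Tendsto (fun i => f i (x i)) l (𝓝 (f₀ x₀)) :=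
  (isBoundedBilinearMap_apply.continuous.tendsto (f₀, x₀)).comp (hf.prodMk_nhds hx)

theorem eventually_norm_sub_lt {T E : Type*} [TopologicalSpace T] [SeminormedAddCommGroup E]
    {f : T → E} {m : T} (hf : ContinuousAt f m) {θ : ℝ} (hθ : 0 < θ) :
    ∀ᶠ t in 𝓝 m, ‖f m - f t‖ < θ := by
  filter_upwards [hf.eventually (Metric.ball_mem_nhds _ hθ)] with t ht
  rwa [← dist_eq_norm, dist_comm]

/-! ### Positivity of the infimum and first-order estimates near a regular parameter -/

section Stability

variable {X Y : Type*} [NormedAddCommGroup X] [InnerProductSpace ℝ X] [CompleteSpace X]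
  [NormedAddCommGroup Y] [InnerProductSpace ℝ Y] [CompleteSpace Y] {p : ℕ}

/-- Near `m` the operators `A_t` are compact and `C¹` in `t`, the derivative at `m` is
`q ↦ dA q m`, and `β²` is not an eigenvalue of `A_m* A_m`. -/
structure IsRegularAt (A : Euc p → X →L[ℝ] Y) (dA : Euc p → Euc p → X →L[ℝ] Y) (β : ℝ)
    (m : Euc p) : Prop where
  contDiffAt : ContDiffAt ℝ 1 A m
  fderiv_apply : ∀ q, fderiv ℝ A m q = dA q m
  compact : ∀ᶠ t in 𝓝 m, IsCompactOperator (A t)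
  not_eigenvalue : ¬ IsSqEigenvalue (A m) β

/-- The derivative `q ↦ ∂_q A_m + A_m ∂_q P_m`. -/
def totalDeriv (A : Euc p → X →L[ℝ] Y) (β : ℝ) (m : Euc p) : Euc p →L[ℝ] X →L[ℝ] Y :=
  fderiv ℝ A m +
    ContinuousLinearMap.compL ℝ X X Y (A m) ∘L fderiv ℝ (fun t => highProj (A t) β) m

variable {A : Euc p → X →L[ℝ] Y} {dA : Euc p → Euc p → X →L[ℝ] Y} {β A₁ A₂ : ℝ} {m : Euc p}

theorem totalDeriv_apply (q : Euc p) (x : X) :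
    totalDeriv A β m q x
      = fderiv ℝ A m q x + A m (fderiv ℝ (fun t => highProj (A t) β) m q x) := rfl

namespace IsRegularAt

theorem isCompactOperator (h : IsRegularAt A dA β m) : IsCompactOperator (A m) :=
  h.compact.self_of_nhds

theorem contDiffAt_highProj (h : IsRegularAt A dA β m) (hβ : 0 < β) :
    ContDiffAt ℝ 1 (fun t => highProj (A t) β) m :=
  StabInv.contDiffAt_highProj hβ.ne' h.contDiffAt h.compact h.not_eigenvalue

theorem continuousAt_totalDeriv (h : IsRegularAt A dA β m) (hβ : 0 < β) :
    ContinuousAt (totalDeriv A β) m := by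
  have h1 : ContinuousAt (fderiv ℝ A) m :=
    (h.contDiffAt.fderiv_right (m := 0) (by simp)).continuousAt
  have h2 : ContinuousAt (fderiv ℝ (fun t => highProj (A t) β)) m :=
    ((h.contDiffAt_highProj hβ).fderiv_right (m := 0) (by simp)).continuousAt
  have h3 : ContinuousAt (fun t => ContinuousLinearMap.compL ℝ X X Y (A t)) m :=
    (ContinuousLinearMap.compL ℝ X X Y).continuous.continuousAt.comp h.contDiffAt.continuousAt
  exact h1.add (h3.clm_comp h2)

theorem deriv_eq (h : IsRegularAt A dA β m) (hβ : 0 < β) (q : Euc p) :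
    dA q m + A m ∘L lineDeriv ℝ (fun t => highProj (A t) β) m q = totalDeriv A β m q := by
  rw [((h.contDiffAt_highProj hβ).differentiableAt one_ne_zero).lineDeriv_eq_fderiv,
    ← h.fderiv_apply]
  rfl

/-- The term with `highProj (A m) β x - x` vanishes on `E_m` and is small for `x` in a nearby `E_t`.
Strictness is needed because both endpoints of an increment move. -/
theorem hasStrictFDerivAt_comp (h : IsRegularAt A dA β m) (hβ : 0 < β) :
    ∃ F' : Euc p →L[ℝ] X →L[ℝ] Y,
      HasStrictFDerivAt (fun t => A t ∘L highProj (A t) β) F' m ∧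
      ∀ q x, F' q x = totalDeriv A β m q x + fderiv ℝ A m q (highProj (A m) β x - x) := by
  have h1 := h.contDiffAt.hasStrictFDerivAt one_ne_zero
  have h2 := (h.contDiffAt_highProj hβ).hasStrictFDerivAt one_ne_zero
  refine ⟨_, h1.clm_comp h2, fun q x => ?_⟩
  rw [totalDeriv_apply, map_sub]
  simp
  abel

theorem closure_highSpace (h : IsRegularAt A dA β m) (hβ : 0 < β) :
    (highSpace (A m) β).topologicalClosure = highSpace (A m) β :=
  StabInv.closure_highSpace h.isCompactOperator hβ

/-- Bounded sequences of vectors in `E_{m_n}` subconverge to a vector of `E_m` if `m_n → m`. -/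
theorem exists_subseq (h : IsRegularAt A dA β m) (hβ : 0 < β) {ms : ℕ → Euc p} {ws : ℕ → X}
    (hms : Tendsto ms atTop (𝓝 m)) (hws : ∀ n, ws n ∈ highSpace (A (ms n)) β) {M : ℝ}
    (hM : ∀ n, ‖ws n‖ ≤ M) :
    ∃ w ∈ highSpace (A m) β, ∃ φ : ℕ → ℕ, StrictMono φ ∧ Tendsto (ws ∘ φ) atTop (𝓝 w) := by
  have := finiteDimensional_highSpace h.isCompactOperator hβ
  have : ProperSpace (highSpace (A m) β).topologicalClosure := FiniteDimensional.proper ℝ _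
  -- Projecting to the fixed finite-dimensional space `E_m` yields a convergent subsequence; the
  -- vectors themselves differ from their projections by at most `‖P_{m_n} - P_m‖ * M → 0`.
  set x : ℕ → (highSpace (A m) β).topologicalClosure := fun n =>
    ⟨highProj (A m) β (ws n), highProj_apply_mem _ _ _⟩ with hx
  obtain ⟨w, -, φ, hφ, hw⟩ := tendsto_subseq_of_bounded (Metric.isBounded_closedBall (x := 0) (r := M))
    (x := x) (fun n => by
      rw [mem_closedBall_zero_iff]
      exact (norm_highProj_apply_le _ _ _).trans (hM n))
  refine ⟨w, (h.closure_highSpace hβ).le w.2, φ, hφ, ?_⟩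
  have h1 : Tendsto (fun n => highProj (A m) β (ws (φ n))) atTop (𝓝 (w : X)) :=
    (continuous_subtype_val.tendsto w).comp hw
  have h2 : Tendsto (fun n => ‖highProj (A (ms (φ n))) β - highProj (A m) β‖ * M) atTop (𝓝 0) := by
    have h3 : Tendsto (fun n => highProj (A (ms (φ n))) β) atTop (𝓝 (highProj (A m) β)) :=
      (h.contDiffAt_highProj hβ).continuousAt.tendsto.comp (hms.comp hφ.tendsto_atTop)
    simpa using (tendsto_iff_norm_sub_tendsto_zero.1 h3).mul_const M
  have h4 : Tendsto (fun n => (highProj (A (ms (φ n))) β - highProj (A m) β) (ws (φ n))) atTop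
      (𝓝 0) := by
    refine squeeze_zero_norm (fun n => ?_) h2
    exact (ContinuousLinearMap.le_opNorm _ _).trans (by gcongr; exact hM _)
  have h5 := h1.add h4
  rw [add_zero] at h5
  refine h5.congr fun n => ?_
  rw [_root_.sub_apply, highProj_eq_self (A (ms (φ n))) β
    (Submodule.le_topologicalClosure _ (hws _)), add_sub_cancel]
  rfl

end IsRegularAt

theorem infDist_le {W : Set (Euc p)} {q m m' : Euc p} {v w : X} (hq : ‖q‖ = 1) (hm : m ∈ W)
    (hm' : m' ∈ W) (hv : v ∈ truncSet (A m') β A₁ A₂) (hw : w ∈ highSpace (A m) β) :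
    infDist A dA β A₁ A₂ W ≤
      edist ((dA q m + A m ∘L lineDeriv ℝ (fun t => highProj (A t) β) m q) v) (A m w) :=
  iInf₂_le_of_le q hq <| iInf₂_le_of_le m hm <| iInf₂_le_of_le m' hm' <|
    iInf₂_le_of_le _ (mem_image_of_mem _ hv) <|
      Metric.infEDist_le_edist_of_mem (mem_image_of_mem _ hw)

theorem le_infDist {W : Set (Euc p)} {c : ℝ≥0∞}
    (h : ∀ q m m' : Euc p, ∀ v w : X, ‖q‖ = 1 → m ∈ W → m' ∈ W → v ∈ truncSet (A m') β A₁ A₂ →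
      w ∈ highSpace (A m) β →
      c ≤ edist ((dA q m + A m ∘L lineDeriv ℝ (fun t => highProj (A t) β) m q) v) (A m w)) :
    c ≤ infDist A dA β A₁ A₂ W := by
  refine le_iInf₂ fun q hq => le_iInf₂ fun m hm => le_iInf₂ fun m' hm' => ?_
  refine le_iInf₂ ?_
  rintro _ ⟨v, hv, rfl⟩
  refine Metric.le_infEDist.2 ?_
  rintro _ ⟨w, hw, rfl⟩
  exact h q m m' v w hq hm hm' hv hw

theorem infDist_anti {W W' : Set (Euc p)} (h : W ⊆ W') :
    infDist A dA β A₁ A₂ W' ≤ infDist A dA β A₁ A₂ W :=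
  le_infDist fun _ _ _ _ _ hq hm hm' hv hw => infDist_le hq (h hm) (h hm') hv hw

theorem infDist_pos {W : Set (Euc p)} (hβ : 0 < β) (hA₁ : 0 < A₁) (hW : IsCompact W)
    (hreg : ∀ m ∈ W, IsRegularAt A dA β m)
    (hU2 : ∀ q : Euc p, ‖q‖ = 1 → ∀ m ∈ W, ∀ u v : X, dA q m u = A m v → u = 0 ∧ v = 0) :
    0 < infDist A dA β A₁ A₂ W := by
  by_contra hcon
  have hex : ∀ n : ℕ, ∃ q m m' : Euc p, ∃ v w : X, ‖q‖ = 1 ∧ m ∈ W ∧ m' ∈ W ∧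
      v ∈ truncSet (A m') β A₁ A₂ ∧ w ∈ highSpace (A m) β ∧
      ‖totalDeriv A β m q v - A m w‖ < 1 / ((n : ℝ) + 1) := by
    intro n
    by_contra! hn
    refine hcon (lt_of_lt_of_le (ENNReal.ofReal_pos.2 (Nat.one_div_pos_of_nat (α := ℝ) (n := n)))
      (le_infDist fun q m m' v w hq hm hm' hv hw => ?_))
    rw [(hreg m hm).deriv_eq hβ, edist_dist, dist_eq_norm]
    exact ENNReal.ofReal_le_ofReal (hn q m m' v w hq hm hm' hv hw)
  choose q m m' v w hq hm hm' hv hw hlt using hex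
  obtain ⟨⟨q₀, m₀, m₀'⟩, ⟨hq₀, hm₀, hm₀'⟩, φ, hφ, hlim⟩ :=
    ((isCompact_sphere (0 : Euc p) 1).prod (hW.prod hW)).tendsto_subseq
      (x := fun n => (q n, m n, m' n))
      (fun n => ⟨by simpa using hq n, hm n, hm' n⟩)
  have hqlim : Tendsto (q ∘ φ) atTop (𝓝 q₀) := (continuous_fst.tendsto _).comp hlim
  have hmlim : Tendsto (m ∘ φ) atTop (𝓝 m₀) :=
    ((continuous_fst.comp continuous_snd).tendsto _).comp hlim
  have hmlim' : Tendsto (m' ∘ φ) atTop (𝓝 m₀') :=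
    ((continuous_snd.comp continuous_snd).tendsto _).comp hlim
  have hr := hreg m₀ hm₀
  have hr' := hreg m₀' hm₀'
  obtain ⟨v₀, hv₀, ψ, hψ, hvlim⟩ := hr'.exists_subseq hβ (ws := v ∘ φ) hmlim'
    (fun n => (hv (φ n)).1) (fun n => (hv (φ n)).2.2)
  replace hqlim := hqlim.comp hψ.tendsto_atTop
  replace hmlim := hmlim.comp hψ.tendsto_atTop
  replace hmlim' := hmlim'.comp hψ.tendsto_atTop
  have hDlim : Tendsto (fun n => totalDeriv A β (m (φ (ψ n))) (q (φ (ψ n))) (v (φ (ψ n)))) atTop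
      (𝓝 (totalDeriv A β m₀ q₀ v₀)) :=
    tendsto_clm_apply (tendsto_clm_apply
      ((hr.continuousAt_totalDeriv hβ).tendsto.comp hmlim) hqlim) hvlim
  obtain ⟨M, hM⟩ := hDlim.norm.bddAbove_range
  -- `A_m` is bounded below by `β` on `E_m`, so near-minimality bounds `w` even though the
  -- definition of `infDist` does not.
  have hwM : ∀ n, ‖w (φ (ψ n))‖ ≤ (M + 1) / β := by
    intro n
    rw [le_div_iff₀ hβ, mul_comm]
    have h1 := mul_norm_le_of_mem_highSpace (A (m (φ (ψ n)))) hβ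
      (Submodule.le_topologicalClosure _ (hw (φ (ψ n))))
    have h2 : ‖totalDeriv A β (m (φ (ψ n))) (q (φ (ψ n))) (v (φ (ψ n)))‖ ≤ M :=
      hM (mem_range_self n)
    have h3 : 1 / ((φ (ψ n) : ℝ) + 1) ≤ 1 := by
      rw [div_le_one (by positivity)]; linarith [(φ (ψ n)).cast_nonneg (α := ℝ)]
    have h4 := norm_sub_norm_le (A (m (φ (ψ n))) (w (φ (ψ n))))
      (totalDeriv A β (m (φ (ψ n))) (q (φ (ψ n))) (v (φ (ψ n))))
    rw [norm_sub_rev] at h4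
    linarith [hlt (φ (ψ n))]
  obtain ⟨w₀, -, χ, hχ, hwlim⟩ := hr.exists_subseq hβ (ws := w ∘ φ ∘ ψ) hmlim
    (fun n => hw (φ (ψ n))) hwM
  have hAw : Tendsto (fun n => A (m (φ (ψ (χ n)))) (w (φ (ψ (χ n))))) atTop (𝓝 (A m₀ w₀)) :=
    tendsto_clm_apply
      (hr.contDiffAt.continuousAt.tendsto.comp (hmlim.comp hχ.tendsto_atTop)) hwlim
  have hzero : totalDeriv A β m₀ q₀ v₀ - A m₀ w₀ = 0 := by
    refine tendsto_nhds_unique ((hDlim.comp hχ.tendsto_atTop).sub hAw)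
      (squeeze_zero_norm (fun n => (hlt _).le) ?_)
    exact tendsto_one_div_add_atTop_nhds_zero_nat.comp
      ((hφ.comp (hψ.comp hχ)).tendsto_atTop)
  -- In the limit `∂_q A v₀ = A (w₀ - ∂_q P v₀)`, an instance of the equation in (U2). It does not
  -- matter that `v₀` belongs to a different `E_{m'}`.
  have hv0 : v₀ = 0 := by
    rw [totalDeriv_apply, hr.fderiv_apply, add_sub_assoc, ← map_sub] at hzero
    refine (hU2 q₀ (by simpa using hq₀) m₀ hm₀ v₀ (w₀ - fderiv ℝ (fun t => highProj (A t) β) m₀ q₀ v₀)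
      ?_).1
    rw [eq_neg_of_add_eq_zero_left hzero, ← map_neg, neg_sub]
  have hAv : Tendsto (fun n => A (m' (φ (ψ n))) (v (φ (ψ n)))) atTop (𝓝 (A m₀' v₀)) :=
    tendsto_clm_apply (hr'.contDiffAt.continuousAt.tendsto.comp hmlim') hvlim
  have := ge_of_tendsto' hAv.norm fun n => (hv (φ (ψ n))).2.1
  rw [hv0, map_zero, norm_zero] at this
  exact absurd hA₁ (not_lt.2 this)

/-- The linearised lower bound for `‖A_m u - A_{m'} v‖` near a regular point. -/
theorem IsRegularAt.exists_lower_bound (h : IsRegularAt A dA β m) (hβ : 0 < β) (hA₂ : 0 < A₂)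
    {η : ℝ} (hη : 0 < η) :
    ∀ᶠ z : Euc p × Euc p in 𝓝 (m, m), ∀ u ∈ highSpace (A z.1) β,
      ∀ v ∈ truncSet (A z.2) β A₁ A₂, z.1 ≠ z.2 → ∃ q : Euc p, ‖q‖ = 1 ∧
        ∃ w ∈ (highSpace (A z.1) β).topologicalClosure,
          (‖totalDeriv A β z.1 q v - A z.1 w‖ - η) * ‖z.2 - z.1‖ ≤ ‖A z.1 u - A z.2 v‖ := by
  obtain ⟨F', hF, hF'⟩ := h.hasStrictFDerivAt_comp hβ
  -- The three remainders below contribute `θ A₂`, `θ A₂` and `‖A'‖ θ A₂` per unit of `‖k‖`, in all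
  -- `θ K = η`.
  set K : ℝ := (2 + ‖fderiv ℝ A m‖) * A₂ with hK
  have hK0 : 0 < K := by positivity
  set θ : ℝ := η / K with hθ
  have hθ0 : 0 < θ := by positivity
  have e1 : ∀ᶠ z : Euc p × Euc p in 𝓝 (m, m),
      ‖A z.2 ∘L highProj (A z.2) β - A z.1 ∘L highProj (A z.1) β - F' (z.2 - z.1)‖
        ≤ θ * ‖z.2 - z.1‖ := by
    have := hF.isLittleO.def hθ0
    exact (continuous_swap.tendsto (m, m)).eventually this
  have e2 : ∀ᶠ z : Euc p × Euc p in 𝓝 (m, m), ‖totalDeriv A β m - totalDeriv A β z.1‖ < θ := by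
    have : ∀ᶠ t in 𝓝 m, ‖totalDeriv A β m - totalDeriv A β t‖ < θ := by
      exact eventually_norm_sub_lt (E := Euc p →L[ℝ] X →L[ℝ] Y) (h.continuousAt_totalDeriv hβ) hθ0
    exact (continuous_fst.tendsto (m, m)).eventually this
  have e3 : ∀ᶠ z : Euc p × Euc p in 𝓝 (m, m), ‖highProj (A m) β - highProj (A z.2) β‖ < θ := by
    have : ∀ᶠ t in 𝓝 m, ‖highProj (A m) β - highProj (A t) β‖ < θ := by
      exact eventually_norm_sub_lt (h.contDiffAt_highProj hβ).continuousAt hθ0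
    exact (continuous_snd.tendsto (m, m)).eventually this
  filter_upwards [e1, e2, e3] with z k1 k2 k3 u hu v hv hne
  set k := z.2 - z.1 with hk
  have hk0 : 0 < ‖k‖ := norm_pos_iff.2 (sub_ne_zero.2 hne.symm)
  set q := ‖k‖⁻¹ • k with hq
  have hqk : ‖k‖ • q = k := smul_inv_smul₀ hk0.ne' k
  have hq1 : ‖q‖ = 1 := by rw [hq, norm_smul, norm_inv, norm_norm, inv_mul_cancel₀ hk0.ne']
  set w := ‖k‖⁻¹ • (u - highProj (A z.1) β v) with hw
  have hkw : ‖k‖ • w = u - highProj (A z.1) β v := smul_inv_smul₀ hk0.ne' _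
  refine ⟨q, hq1, w, Submodule.smul_mem _ _ (Submodule.sub_mem _
    (Submodule.le_topologicalClosure _ hu) (highProj_apply_mem _ _ _)), ?_⟩
  have hPv : highProj (A z.2) β v = v :=
    highProj_eq_self _ _ (Submodule.le_topologicalClosure _ hv.1)
  have hv2 : ‖v‖ ≤ A₂ := hv.2.2
  -- `r1` is the error of strict differentiability, `r2` comes from moving the derivative from `m`
  -- to `z.1`, and `r3` is the off-range term, since `P_m v - v = (P_m - P_{z.2}) v`.
  set r1 := (A z.2 ∘L highProj (A z.2) β - A z.1 ∘L highProj (A z.1) β - F' k) v with hr1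
  set r2 := (totalDeriv A β m - totalDeriv A β z.1) k v with hr2
  set r3 := fderiv ℝ A m k ((highProj (A m) β - highProj (A z.2) β) v) with hr3
  have key : A z.2 v - A z.1 u = ‖k‖ • (totalDeriv A β z.1 q v - A z.1 w) + (r1 + r2 + r3) := by
    have h1 : ‖k‖ • totalDeriv A β z.1 q v = totalDeriv A β z.1 k v := by
      rw [← _root_.smul_apply, ← map_smul, hqk]
    have h2 : ‖k‖ • A z.1 w = A z.1 u - A z.1 (highProj (A z.1) β v) := by
      rw [← map_smul, hkw, map_sub]
    rw [smul_sub, h1, h2, hr1, hr2, hr3]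
    simp only [_root_.sub_apply, ContinuousLinearMap.comp_apply, hPv, hF']
    abel
  have b1 : ‖r1‖ ≤ θ * ‖k‖ * A₂ :=
    (ContinuousLinearMap.le_opNorm _ _).trans (by gcongr)
  have b2 : ‖r2‖ ≤ θ * ‖k‖ * A₂ :=
    (ContinuousLinearMap.le_opNorm₂ _ _ _).trans (by gcongr)
  have b3 : ‖r3‖ ≤ ‖fderiv ℝ A m‖ * ‖k‖ * (θ * A₂) :=
    (ContinuousLinearMap.le_opNorm₂ _ _ _).trans (by
      gcongr
      exact (ContinuousLinearMap.le_opNorm _ _).trans (by gcongr))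
  have b : ‖r1 + r2 + r3‖ ≤ η * ‖k‖ := by
    have hηK : η = θ * K := by rw [hθ, div_mul_cancel₀ _ hK0.ne']
    refine (norm_add₃_le).trans ((add_le_add (add_le_add b1 b2) b3).trans (le_of_eq ?_))
    rw [hηK, hK]; ring
  have hn : ‖‖k‖ • (totalDeriv A β z.1 q v - A z.1 w)‖
      = ‖k‖ * ‖totalDeriv A β z.1 q v - A z.1 w‖ := by rw [norm_smul, norm_norm]
  have := norm_sub_le (A z.2 v - A z.1 u) (r1 + r2 + r3)
  rw [key, add_sub_cancel_right, ← key, hn, norm_sub_rev (A z.2 v)] at this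
  linarith

/-- Close to a regular point `m`, the vectors in `T_{m'}` are close to vectors in `T_m`. -/
theorem IsRegularAt.eventually_exists_truncSet_near (h : IsRegularAt A dA β m) (hβ : 0 < β)
    {η : ℝ} (hη : 0 < η) :
    ∀ᶠ t in 𝓝 m, ∀ v ∈ truncSet (A t) β A₁ A₂, ∃ v₀ ∈ truncSet (A m) β A₁ A₂, ‖v₀ - v‖ < η := by
  -- Otherwise a sequence `t → m` has vectors staying at distance at least `η` from the truncated
  -- set at `m`; a subsequential limit lies in that set because both norm constraints are closed.
  by_contra hcon
  obtain ⟨ms, hms, hfail⟩ := exists_seq_forall_of_frequently (not_eventually.1 hcon)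
  push Not at hfail
  choose v hv hfar using hfail
  obtain ⟨v₀, hv₀, φ, hφ, hlim⟩ := h.exists_subseq hβ hms (fun n => (hv n).1) (fun n => (hv n).2.2)
  have hA : Tendsto (fun n => A (ms (φ n)) (v (φ n))) atTop (𝓝 (A m v₀)) :=
    tendsto_clm_apply
      (h.contDiffAt.continuousAt.tendsto.comp (hms.comp hφ.tendsto_atTop)) hlim
  have hmem : v₀ ∈ truncSet (A m) β A₁ A₂ :=
    ⟨hv₀, ge_of_tendsto' hA.norm fun n => (hv _).2.1, le_of_tendsto' hlim.norm fun n => (hv _).2.2⟩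
  have h0 : Tendsto (fun n => ‖v₀ - v (φ n)‖) atTop (𝓝 0) := by
    have := (tendsto_const_nhds (x := v₀)).sub hlim
    simpa using this.norm
  obtain ⟨n, hn⟩ := (h0.eventually_lt_const hη).exists
  exact absurd (hfar (φ n) v₀ hmem) (not_le.2 hn)

/-- A stability constant on a neighbourhood of `m` is at most each of the linearised distances
at `m`. -/
theorem IsRegularAt.stabilityConst_le (h : IsRegularAt A dA β m) (hβ : 0 < β) {W : Set (Euc p)}
    (hW : W ∈ 𝓝 m) (hreg : ∀ t ∈ W, IsRegularAt A dA β t) {C : ℝ≥0∞}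
    (hC : IsStabilityConst A β A₁ A₂ W C) {q : Euc p} (hq : ‖q‖ = 1) {v w : X}
    (hv : v ∈ truncSet (A m) β A₁ A₂) (hw : w ∈ highSpace (A m) β) :
    C ≤ ENNReal.ofReal ‖totalDeriv A β m q v - A m w‖ := by
  obtain ⟨F', hF, hF'⟩ := h.hasStrictFDerivAt_comp hβ
  have hPv : highProj (A m) β v = v :=
    highProj_eq_self _ _ (Submodule.le_topologicalClosure _ hv.1)
  have hPw : highProj (A m) β w = w :=
    highProj_eq_self _ _ (Submodule.le_topologicalClosure _ hw)
  -- Test the stability inequality at `m - t q` and `m`, with `u = P_{m - t q} (v + t w)`: the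
  -- quotient `(f t - f 0) / t` tends to `A_m w - D_m(q) v`.
  set f : ℝ → Y := fun t => (A (m - t • q) ∘L highProj (A (m - t • q)) β) (v + t • w) with hf
  have hline : HasDerivAt (fun t : ℝ => m - t • q) (-q) 0 := by
    simpa using ((hasDerivAt_id (0 : ℝ)).smul_const q).const_sub m
  have hline' : HasDerivAt (fun t : ℝ => v + t • w) w 0 := by
    simpa using ((hasDerivAt_id (0 : ℝ)).smul_const w).const_add v
  have hFd : HasDerivAt (fun t : ℝ => A (m - t • q) ∘L highProj (A (m - t • q)) β) (F' (-q)) 0 := by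
    have hF0 : HasFDerivAt (fun t => A t ∘L highProj (A t) β) F' (m - (0 : ℝ) • q) := by
      simpa using hF.hasFDerivAt
    exact hF0.comp_hasDerivAt 0 hline
  have hderiv : HasDerivAt f (A m w - totalDeriv A β m q v) 0 := by
    convert hFd.clm_apply hline' using 1
    simp [hF', hPv, hPw]
    abel
  have hf0 : f 0 = A m v := by simp [hf, hPv]
  have hlim := hderiv.tendsto_slope_zero_right
  simp only [zero_add, hf0] at hlim
  rw [norm_sub_rev]
  refine ge_of_tendsto ((ENNReal.continuous_ofReal.tendsto _).comp hlim.norm) ?_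
  have hin : ∀ᶠ t : ℝ in 𝓝[>] 0, m - t • q ∈ W := by
    have : Tendsto (fun t : ℝ => m - t • q) (𝓝 0) (𝓝 m) := by
      simpa using hline.continuousAt.tendsto
    exact (this.mono_left nhdsWithin_le_nhds).eventually hW
  filter_upwards [hin, self_mem_nhdsWithin] with t ht ht0
  have ht0' : (0 : ℝ) < t := ht0
  have hu : highProj (A (m - t • q)) β (v + t • w) ∈ highSpace (A (m - t • q)) β := by
    rw [← (hreg _ ht).closure_highSpace hβ]
    exact highProj_apply_mem _ _ _
  have hst := hC _ ht m (mem_of_mem_nhds hW) _ hu v hv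
  have hd : edist (m - t • q) m = ENNReal.ofReal t := by
    rw [edist_dist, dist_eq_norm, sub_sub_cancel_left, norm_neg, norm_smul, hq, mul_one,
      Real.norm_of_nonneg ht0'.le]
  have hd2 : edist (A (m - t • q) (highProj (A (m - t • q)) β (v + t • w))) (A m v)
      = ENNReal.ofReal ‖f t - A m v‖ := by rw [edist_dist, dist_eq_norm]; rfl
  rw [hd, hd2] at hst
  change C ≤ ENNReal.ofReal ‖t⁻¹ • (f t - A m v)‖
  rw [norm_smul, norm_inv, Real.norm_of_nonneg ht0'.le, inv_mul_eq_div,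
    ENNReal.ofReal_div_of_pos ht0', ENNReal.le_div_iff_mul_le
      (Or.inl (ENNReal.ofReal_pos.2 ht0').ne') (Or.inl ENNReal.ofReal_ne_top)]
  exact hst

end Stability

/-! ### From first-order estimates to asymptotically sharp constants -/

section Asymptotics

variable {X Y : Type*} [NormedAddCommGroup X] [InnerProductSpace ℝ X] [CompleteSpace X]
  [NormedAddCommGroup Y] [InnerProductSpace ℝ Y] [CompleteSpace Y] {p : ℕ}
  {A : Euc p → X →L[ℝ] Y} {dA : Euc p → Euc p → X →L[ℝ] Y} {β A₁ A₂ : ℝ} {m₀ : Euc p}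

/-- Close to a regular point, `(1 - ε) I(W)` is a stability constant for every `W` on which
`I(W)` is bounded below by a fixed constant. -/
theorem IsRegularAt.exists_isStabilityConst (h : IsRegularAt A dA β m₀) (hβ : 0 < β) (hA₂ : 0 < A₂)
    {ε I₀ : ℝ} (hε : 0 < ε) (hε1 : ε < 1) (hI₀ : 0 < I₀) :
    ∃ δ : ℝ, 0 < δ ∧ ∀ W : Set (Euc p), W ⊆ Metric.closedBall m₀ δ →
      (∀ m ∈ W, IsRegularAt A dA β m) → ENNReal.ofReal I₀ ≤ infDist A dA β A₁ A₂ W →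
      IsStabilityConst A β A₁ A₂ W (ENNReal.ofReal (1 - ε) * infDist A dA β A₁ A₂ W) := by
  have hev := h.exists_lower_bound (A₁ := A₁) hβ hA₂ (mul_pos hε hI₀)
  rw [nhds_prod_eq] at hev
  obtain ⟨U, hU, hUW⟩ := mem_prod_self_iff.1 hev
  obtain ⟨δ, hδ, hball⟩ := Metric.nhds_basis_closedBall.mem_iff.1 hU
  refine ⟨δ, hδ, fun W hW hreg hI m hm m' hm' u hu v hv => ?_⟩
  rcases eq_or_ne m m' with rfl | hne
  · simp
  obtain ⟨q, hq, w, hw, hle⟩ :=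
    hUW (show (m, m') ∈ U ×ˢ U from ⟨hball (hW hm), hball (hW hm')⟩) u hu v hv hne
  rw [(hreg m hm).closure_highSpace hβ] at hw
  have hId := infDist_le (dA := dA) hq hm hm' hv hw
  rw [(hreg m hm).deriv_eq hβ, edist_dist, dist_eq_norm] at hId
  set D := ‖totalDeriv A β m q v - A m w‖ with hD
  -- The infimum is finite here, since an actual pair `v`, `w` bounds it.
  obtain ⟨i, hi⟩ : ∃ i : ℝ, infDist A dA β A₁ A₂ W = ENNReal.ofReal i :=
    ⟨_, (ENNReal.ofReal_toReal (ne_top_of_le_ne_top ENNReal.ofReal_ne_top hId)).symm⟩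
  rw [hi] at hI hId ⊢
  have hi0 : 0 < i := ENNReal.ofReal_pos.1 ((ENNReal.ofReal_pos.2 hI₀).trans_le hI)
  have h1 : I₀ ≤ i := (ENNReal.ofReal_le_ofReal_iff hi0.le).1 hI
  have h2 : i ≤ D := (ENNReal.ofReal_le_ofReal_iff (norm_nonneg _)).1 hId
  rw [edist_dist, edist_dist, ← ENNReal.ofReal_mul (by linarith),
    ← ENNReal.ofReal_mul (mul_nonneg (by linarith) hi0.le)]
  refine ENNReal.ofReal_le_ofReal ?_
  rw [dist_comm m, dist_eq_norm, dist_eq_norm]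
  refine le_trans (mul_le_mul_of_nonneg_right ?_ (norm_nonneg _)) hle
  nlinarith

/-- Close to a regular point, every stability constant is at most `(1 + ε) I(W)`, for every `W` on
which `I(W)` is bounded below by a fixed constant. -/
theorem IsRegularAt.exists_stabilityConst_le (h : IsRegularAt A dA β m₀) (hβ : 0 < β) (hA₂ : 0 < A₂)
    {ε I₀ : ℝ} (hε : 0 < ε) (hI₀ : 0 < I₀) :
    ∃ δ : ℝ, 0 < δ ∧ ∀ W : Set (Euc p), W ⊆ Metric.closedBall m₀ δ → W ∈ 𝓝 m₀ →
      (∀ m ∈ W, IsRegularAt A dA β m) → ENNReal.ofReal I₀ ≤ infDist A dA β A₁ A₂ W →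
      ∀ C : ℝ≥0∞, IsStabilityConst A β A₁ A₂ W C →
        C ≤ ENNReal.ofReal (1 + ε) * infDist A dA β A₁ A₂ W := by
  set K₁ : ℝ := ‖totalDeriv A β m₀‖ with hK₁
  -- Moving base point and vectors to `m₀` costs at most `η (K + D / β)`, where `D` is the distance
  -- at the original point and the `D / β` comes from the bound on `w`. As `D ≥ I₀`, `K ≤ (K / I₀)
  -- D`, so this `η` makes the cost at most `ε D`.
  set K : ℝ := A₂ + K₁ + (K₁ + 1) * A₂ / β with hK
  have hK0 : 0 < K := by positivity
  set η : ℝ := min 1 (ε / (K / I₀ + 1 / β)) with hη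
  have hη0 : 0 < η := by positivity
  have hη1 : η ≤ 1 := min_le_left _ _
  have hηε : η * (K / I₀ + 1 / β) ≤ ε := by
    rw [← le_div_iff₀ (by positivity)]; exact min_le_right _ _
  have e1 : ∀ᶠ t in 𝓝 m₀, ‖totalDeriv A β m₀ - totalDeriv A β t‖ < η :=
    eventually_norm_sub_lt (E := Euc p →L[ℝ] X →L[ℝ] Y) (h.continuousAt_totalDeriv hβ) hη0
  have e2 : ∀ᶠ t in 𝓝 m₀,
      ‖A m₀ ∘L highProj (A m₀) β - A t ∘L highProj (A t) β‖ < η :=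
    eventually_norm_sub_lt
      (h.contDiffAt.continuousAt.clm_comp (h.contDiffAt_highProj hβ).continuousAt) hη0
  have e3 := h.eventually_exists_truncSet_near (A₁ := A₁) (A₂ := A₂) hβ hη0
  obtain ⟨δ, hδ, hball⟩ := Metric.nhds_basis_closedBall.eventually_iff.1 (e1.and (e2.and e3))
  refine ⟨δ, hδ, fun W hW hWm hreg hI C hC => ?_⟩
  have ha0 : ENNReal.ofReal (1 + ε) ≠ 0 := (ENNReal.ofReal_pos.2 (by linarith)).ne'
  rw [← ENNReal.div_le_iff' ha0 ENNReal.ofReal_ne_top]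
  refine le_infDist fun q m m' v w hq hm hm' hv hw => ?_
  have hId := infDist_le (dA := dA) hq hm hm' hv hw
  rw [(hreg m hm).deriv_eq hβ, edist_dist, dist_eq_norm] at hId ⊢
  set D := ‖totalDeriv A β m q v - A m w‖ with hD
  have hID : I₀ ≤ D := (ENNReal.ofReal_le_ofReal_iff (norm_nonneg _)).1 (hI.trans hId)
  obtain ⟨k1, k2, -⟩ := hball (hW hm)
  obtain ⟨v₀, hv₀, hvv₀⟩ := (hball (hW hm')).2.2 v hv
  rw [ENNReal.div_le_iff' ha0 ENNReal.ofReal_ne_top, ← ENNReal.ofReal_mul (by linarith)]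
  have hw₀ : highProj (A m₀) β w ∈ highSpace (A m₀) β := by
    rw [← h.closure_highSpace hβ]
    exact highProj_apply_mem _ _ _
  refine (h.stabilityConst_le hβ hWm hreg hC hq hv₀ hw₀).trans (ENNReal.ofReal_le_ofReal ?_)
  have hPw : highProj (A m) β w = w :=
    highProj_eq_self _ _ (Submodule.le_topologicalClosure _ hw)
  have hvA : ‖v‖ ≤ A₂ := hv.2.2
  have hw1 : ‖w‖ ≤ (D + (K₁ + 1) * A₂) / β := by
    rw [le_div_iff₀ hβ, mul_comm]
    refine (mul_norm_le_of_mem_highSpace (A m) hβ (Submodule.le_topologicalClosure _ hw)).trans ?_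
    have b1 : ‖totalDeriv A β m‖ ≤ K₁ + 1 := by
      linarith [norm_le_insert (totalDeriv A β m₀) (totalDeriv A β m)]
    have b2 : ‖totalDeriv A β m q v‖ ≤ (K₁ + 1) * A₂ := by
      refine (ContinuousLinearMap.le_opNorm₂ _ _ _).trans ?_
      rw [hq, mul_one]
      gcongr
    have := norm_sub_norm_le (A m w) (totalDeriv A β m q v)
    rw [norm_sub_rev] at this
    linarith
  set r1 := (totalDeriv A β m₀ - totalDeriv A β m) q v with hr1
  set r2 := totalDeriv A β m₀ q (v₀ - v) with hr2
  set r3 := (A m₀ ∘L highProj (A m₀) β - A m ∘L highProj (A m) β) w with hr3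
  have key : totalDeriv A β m₀ q v₀ - A m₀ (highProj (A m₀) β w)
      = (totalDeriv A β m q v - A m w) + (r1 + r2 - r3) := by
    rw [hr1, hr2, hr3, map_sub]
    simp only [_root_.sub_apply, ContinuousLinearMap.comp_apply, hPw]
    abel
  have b1 : ‖r1‖ ≤ η * A₂ := by
    refine (ContinuousLinearMap.le_opNorm₂ _ _ _).trans ?_
    rw [hq, mul_one]
    gcongr
  have b2 : ‖r2‖ ≤ K₁ * η := by
    refine (ContinuousLinearMap.le_opNorm₂ _ _ _).trans ?_
    rw [hq, mul_one]
    gcongr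
  have b3 : ‖r3‖ ≤ η * ((D + (K₁ + 1) * A₂) / β) :=
    (ContinuousLinearMap.le_opNorm _ _).trans (by gcongr)
  have b : ‖r1 + r2 - r3‖ ≤ η * A₂ + K₁ * η + η * ((D + (K₁ + 1) * A₂) / β) :=
    (norm_sub_le _ _).trans (add_le_add ((norm_add_le _ _).trans (add_le_add b1 b2)) b3)
  rw [key]
  refine (norm_add_le _ _).trans ((add_le_add_right b D).trans ?_)
  have hKD : K ≤ K / I₀ * D := by
    rw [div_mul_eq_mul_div, le_div_iff₀ hI₀]
    gcongr
  calc D + (η * A₂ + K₁ * η + η * ((D + (K₁ + 1) * A₂) / β))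
      = D + η * (K + 1 / β * D) := by rw [hK]; ring
    _ ≤ D + η * (K / I₀ * D + 1 / β * D) := by gcongr
    _ = D + η * (K / I₀ + 1 / β) * D := by ring
    _ ≤ D + ε * D := by gcongr
    _ = (1 + ε) * D := by ring

/-- The abstract form of the theorem, for a family of compact operators that is `C¹` near each
point of a compact set `B`. -/
theorem stability_of_contDiffAt {B : Set (Euc p)} (hB : IsCompact B)
    (hA : ∀ m ∈ B, ContDiffAt ℝ 1 A m) (hdA : ∀ m ∈ B, ∀ q, fderiv ℝ A m q = dA q m)
    (hcpt : ∀ m ∈ B, ∀ᶠ t in 𝓝 m, IsCompactOperator (A t))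
    (hU2 : ∀ q : Euc p, ‖q‖ = 1 → ∀ m ∈ B, ∀ u v : X, dA q m u = A m v → u = 0 ∧ v = 0)
    (hβ : 0 < β) (hA₁ : 0 < A₁) (hA₂ : 0 < A₂) (hm₀ : m₀ ∈ B) :
    (∀ W : Set (Euc p), IsGoodNhd A β B m₀ W →
      (∀ m ∈ W, ContDiffAt ℝ 1 (fun t => highProj (A t) β) m) ∧
      0 < infDist A dA β A₁ A₂ W) ∧
    (∀ ε : ℝ, 0 < ε → ε < 1 → ∃ δ : ℝ, 0 < δ ∧
      ∀ W : Set (Euc p), IsGoodNhd A β B m₀ W → W ⊆ Metric.closedBall m₀ δ →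
        IsStabilityConst A β A₁ A₂ W (ENNReal.ofReal (1 - ε) * infDist A dA β A₁ A₂ W) ∧
        (m₀ ∈ interior B → ∀ C : ℝ≥0∞, IsStabilityConst A β A₁ A₂ W C →
          C ≤ ENNReal.ofReal (1 + ε) * infDist A dA β A₁ A₂ W)) := by
  have hreg : ∀ W : Set (Euc p), IsGoodNhd A β B m₀ W → ∀ m ∈ W, IsRegularAt A dA β m :=
    fun W hW m hm => ⟨hA m (hW.1 hm), hdA m (hW.1 hm), hcpt m (hW.1 hm), hW.2.2.2.2 m hm⟩
  have hpos : ∀ W : Set (Euc p), IsGoodNhd A β B m₀ W → 0 < infDist A dA β A₁ A₂ W :=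
    fun W hW => infDist_pos hβ hA₁ (hB.of_isClosed_subset hW.2.2.1 hW.1) (hreg W hW)
      fun q hq m hm => hU2 q hq m (hW.1 hm)
  refine ⟨fun W hW => ⟨fun m hm => (hreg W hW m hm).contDiffAt_highProj hβ, hpos W hW⟩,
    fun ε hε hε1 => ?_⟩
  -- A single admissible `W₀` supplies regularity at `m₀` and the uniform lower bound `I₀`, by
  -- monotonicity of the infimum; if there is none, the claim is vacuous.
  by_cases hex : ∃ W₀, IsGoodNhd A β B m₀ W₀
  · obtain ⟨W₀, hW₀⟩ := hex
    have hr := hreg W₀ hW₀ m₀ (mem_of_mem_nhdsWithin hm₀ hW₀.2.1)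
    obtain ⟨δ₀, hδ₀, hsub⟩ := (nhdsWithin_hasBasis Metric.nhds_basis_closedBall B).mem_iff.1 hW₀.2.1
    -- The cut at `1` keeps `I₀` real when the infimum is `∞`.
    set I₀ : ℝ := (min (infDist A dA β A₁ A₂ W₀) 1).toReal with hI₀
    have hmin : min (infDist A dA β A₁ A₂ W₀) 1 ≠ ⊤ :=
      ne_top_of_le_ne_top ENNReal.one_ne_top (min_le_right _ _)
    have hI₀pos : 0 < I₀ :=
      ENNReal.toReal_pos (lt_min (hpos W₀ hW₀) one_pos).ne' hmin
    obtain ⟨δ₁, hδ₁, h1⟩ := hr.exists_isStabilityConst (A₁ := A₁) hβ hA₂ hε hε1 hI₀pos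
    obtain ⟨δ₂, hδ₂, h2⟩ := hr.exists_stabilityConst_le (A₁ := A₁) hβ hA₂ hε hI₀pos
    refine ⟨min δ₀ (min δ₁ δ₂), by positivity, fun W hW hWδ => ?_⟩
    have hWW₀ : W ⊆ W₀ := fun m hm => hsub
      ⟨Metric.closedBall_subset_closedBall (min_le_left _ _) (hWδ hm), hW.1 hm⟩
    have hI : ENNReal.ofReal I₀ ≤ infDist A dA β A₁ A₂ W := by
      rw [hI₀, ENNReal.ofReal_toReal hmin]
      exact (min_le_left _ _).trans (infDist_anti hWW₀)
    refine ⟨h1 W (hWδ.trans (Metric.closedBall_subset_closedBall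
      ((min_le_right _ _).trans (min_le_left _ _)))) (hreg W hW) hI, fun hint C hC => ?_⟩
    refine h2 W (hWδ.trans (Metric.closedBall_subset_closedBall
      ((min_le_right _ _).trans (min_le_right _ _)))) ?_ (hreg W hW) hI C hC
    have := hW.2.1
    rwa [nhdsWithin_eq_nhds.2 (mem_interior_iff_mem_nhds.1 hint)] at this
  · exact ⟨1, one_pos, fun W hW => absurd ⟨W, hW⟩ hex⟩

end Asymptotics

/-! ### Finiteness of the surface measure -/

section SurfaceMeasure

variable {d : ℕ}

/-- Bounded parts of a coordinate subspace have finite Hausdorff measure. -/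
theorem hausdorffMeasure_slice_inter_ball_lt_top {r : ℕ} (hr : r ≤ d) (c : Euc d) (ρ : ℝ) :
    Measure.hausdorffMeasure (r : ℝ) (slice d r ∩ Metric.ball c ρ) < ⊤ := by
  let incl : Euc r →ₗ[ℝ] Euc d :=
    { toFun := fun z => WithLp.toLp 2 fun i => if h : (i : ℕ) < r then z ⟨i, h⟩ else 0
      map_add' := fun x y => by ext i; by_cases h : (i : ℕ) < r <;> simp [h]
      map_smul' := fun c x => by ext i; by_cases h : (i : ℕ) < r <;> simp [h] }
  let proj : Euc d →ₗ[ℝ] Euc r :=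
    { toFun := fun z => WithLp.toLp 2 fun i => z (Fin.castLE hr i)
      map_add' := fun x y => by ext i; simp
      map_smul' := fun c x => by ext i; simp }
  have hincl := (LinearMap.toContinuousLinearMap incl).lipschitz
  have hproj := (LinearMap.toContinuousLinearMap proj).lipschitz
  -- Inclusion after projection is the identity on the slice, so the piece is a Lipschitz image of a
  -- bounded subset of `Euc r`, which has finite `r`-dimensional measure.
  have hsub : slice d r ∩ Metric.ball c ρ ⊆
      LinearMap.toContinuousLinearMap incl ''
        (LinearMap.toContinuousLinearMap proj '' Metric.ball c ρ) := by
    rintro z ⟨hz, hzb⟩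
    refine ⟨_, ⟨z, hzb, rfl⟩, ?_⟩
    ext i
    by_cases h : (i : ℕ) < r
    · simp [incl, proj, h]
    · simp [incl, proj, h, hz i (not_lt.1 h)]
  refine (measure_mono hsub).trans_lt
    ((hincl.hausdorffMeasure_image_le (Nat.cast_nonneg r) _).trans_lt ?_)
  refine ENNReal.mul_lt_top (ENNReal.rpow_lt_top_of_nonneg (Nat.cast_nonneg r)
    ENNReal.coe_ne_top) ?_
  exact (hproj.isBounded_image Metric.isBounded_ball).measure_lt_top

/-- Interior and boundary charts need no separate treatment: a half slice is contained in the slice,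
and only an upper bound on the measure is sought. -/
theorem exists_subset_image_slice {r : ℕ} {R : Set (Euc d)} (hmfd : IsSubmanifold r R) {x : Euc d}
    (hx : x ∈ R) : ∃ N ∈ 𝓝 x, ∃ (f : Euc d → Euc d) (K : NNReal) (c : Euc d) (ρ : ℝ),
      LipschitzOnWith K f (slice d r ∩ Metric.ball c ρ) ∧
      R ∩ N ⊆ f '' (slice d r ∩ Metric.ball c ρ) := by
  obtain ⟨Φ, hxΦ, hΦ⟩ := hmfd.2 x hx
  have hΦ' : (∃ K : NNReal, LipschitzOnWith K Φ Φ.source ∧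
      LipschitzOnWith K Φ.symm Φ.target) ∧ ∀ x ∈ Φ.source, x ∈ R → Φ x ∈ slice d r := by
    rcases hΦ with h | h
    · exact ⟨h.1, fun y hy hyR => (h.2 y hy).1 hyR⟩
    · exact ⟨h.1, fun y hy hyR => ((h.2 y hy).1 hyR).1⟩
  obtain ⟨⟨K, -, hK⟩, hRS⟩ := hΦ'
  obtain ⟨ρ, hρ, hball⟩ := Metric.isOpen_iff.1 Φ.open_target (Φ x) (Φ.map_source hxΦ)
  refine ⟨Φ.source ∩ Φ ⁻¹' Metric.ball (Φ x) ρ,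
    inter_mem (Φ.open_source.mem_nhds hxΦ) ((Φ.continuousAt hxΦ).preimage_mem_nhds
      (Metric.ball_mem_nhds (Φ x) hρ)),
    Φ.symm, K, Φ x, ρ, hK.mono (inter_subset_right.trans hball), ?_⟩
  rintro y ⟨hyR, hys, hyb⟩
  exact ⟨Φ y, ⟨hRS y hys hyR, hyb⟩, Φ.left_inv hys⟩

/-- A compact Lipschitz submanifold has finite Hausdorff measure. -/
theorem hausdorffMeasure_lt_top_of_isSubmanifold {r : ℕ} {R : Set (Euc d)} (hR : IsCompact R)
    (hmfd : IsSubmanifold r R) : Measure.hausdorffMeasure (r : ℝ) R < ⊤ := by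
  refine hR.measure_lt_top_of_nhdsWithin fun x hx => ?_
  obtain ⟨N, hN, f, K, c, ρ, hf, hsub⟩ := exists_subset_image_slice hmfd hx
  refine ⟨R ∩ N, inter_mem_nhdsWithin R hN, (measure_mono hsub).trans_lt ?_⟩
  refine (hf.hausdorffMeasure_image_le (Nat.cast_nonneg r)).trans_lt ?_
  exact ENNReal.mul_lt_top (ENNReal.rpow_lt_top_of_nonneg (Nat.cast_nonneg r)
    ENNReal.coe_ne_top) (hausdorffMeasure_slice_inter_ball_lt_top hmfd.1 _ _)

/-- The surface measure of a compact Lipschitz submanifold is finite. -/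
theorem isFiniteMeasure_surf {r : ℕ} {R : Set (Euc d)} (hR : IsCompact R)
    (hmfd : IsSubmanifold r R) : IsFiniteMeasure (surf r R) := by
  have : IsFiniteMeasure ((Measure.hausdorffMeasure (r : ℝ)).restrict R) :=
    ⟨by simpa using hausdorffMeasure_lt_top_of_isSubmanifold hR hmfd⟩
  rw [surf, Measure.euclideanHausdorffMeasure_def, Measure.restrict_smul]
  infer_instance

theorem ae_mem_surf {r : ℕ} {R : Set (Euc d)} (hR : IsCompact R) : ∀ᵐ y ∂(surf r R), y ∈ R :=
  ae_restrict_mem hR.measurableSet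

end SurfaceMeasure

/-! ### Integral operators with continuous kernels -/

section KernelOperator

variable {α : Type*} [TopologicalSpace α] [T2Space α] [MeasurableSpace α] [BorelSpace α]

theorem memLp_extend {S : Set α} [CompactSpace S] (μ : Measure α) [IsFiniteMeasure μ]
    (f : C(S, ℝ)) : MemLp (Function.extend Subtype.val f 0) 2 μ := by
  refine MemLp.of_bound (Measurable.aestronglyMeasurable ?_) ‖f‖ (ae_of_all _ fun y => ?_)
  · exact (MeasurableEmbedding.subtype_coe
      (isCompact_iff_compactSpace.2 ‹_›).measurableSet).measurable_extend
        f.continuous.measurable measurable_zero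
  · by_cases hy : y ∈ S
    · rw [show y = ((⟨y, hy⟩ : S) : α) from rfl, Subtype.val_injective.extend_apply]
      exact f.norm_coe_le_norm _
    · rw [Function.extend_apply' _ _ _ (by rintro ⟨a, rfl⟩; exact hy a.2)]
      simp

/-- Extension by zero of a continuous function on a compact set, as an element of `L²`. -/
def contToL2 (S : Set α) [CompactSpace S] (μ : Measure α) [IsFiniteMeasure μ] :
    C(S, ℝ) →L[ℝ] Lp ℝ 2 μ :=
  LinearMap.mkContinuous
    { toFun := fun f => (memLp_extend μ f).toLp _
      map_add' := fun f g => by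
        rw [← MemLp.toLp_add]
        congr 1
        rw [← Function.extend_add]
        simp
      map_smul' := fun c f => by
        rw [RingHom.id_apply, ← MemLp.toLp_const_smul]
        congr 1
        rw [← Function.extend_smul]
        simp }
    ((measureUnivNNReal μ : ℝ) ^ (2 : ℝ≥0∞).toReal⁻¹) fun f => by
      refine Lp.norm_le_of_ae_bound (norm_nonneg _) ?_
      filter_upwards [MemLp.coeFn_toLp (memLp_extend μ f)] with y hy
      change ‖((memLp_extend μ f).toLp _ : α → ℝ) y‖ ≤ _
      rw [hy]
      by_cases hyS : y ∈ S
      · rw [show y = ((⟨y, hyS⟩ : S) : α) from rfl, Subtype.val_injective.extend_apply]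
        exact f.norm_coe_le_norm _
      · rw [Function.extend_apply' _ _ _ (by rintro ⟨a, rfl⟩; exact hyS a.2)]
        simp

theorem contToL2_ae {S : Set α} [CompactSpace S] {μ : Measure α} [IsFiniteMeasure μ]
    (hS : ∀ᵐ y ∂μ, y ∈ S) {f : C(S, ℝ)} {g : α → ℝ} (hfg : ∀ y : S, f y = g y) :
    contToL2 S μ f =ᵐ[μ] g := by
  have h : contToL2 S μ f =ᵐ[μ] Function.extend Subtype.val f 0 := MemLp.coeFn_toLp (memLp_extend μ f)
  filter_upwards [h, hS] with y hy hyS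
  rw [hy, show y = ((⟨y, hyS⟩ : S) : α) from rfl, Subtype.val_injective.extend_apply, hfg]

variable {γ : Type*} [TopologicalSpace γ] [T2Space γ] [MeasurableSpace γ] [BorelSpace γ]

variable {V : Set γ} {S : Set α} [CompactSpace V] [CompactSpace S] {ν : Measure γ}
  {μ : Measure α} [IsFiniteMeasure ν] [IsFiniteMeasure μ]

/-- The function `x ↦ ∫ κ(x, y) g(y) dμ(y)`. -/
def innerCont (κ : C(V × S, ℝ)) (g : Lp ℝ 2 μ) : C(V, ℝ) :=
  ⟨fun x => inner ℝ (contToL2 S μ (κ.curry x)) g, by fun_prop⟩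

omit [T2Space γ] [MeasurableSpace γ] [BorelSpace γ] [CompactSpace V] in
theorem innerCont_apply (κ : C(V × S, ℝ)) (g : Lp ℝ 2 μ) (x : V) :
    innerCont κ g x = inner ℝ (contToL2 S μ (κ.curry x)) g := rfl

variable (V S ν μ) in
/-- The integral operator `L²(S) → L²(V)` with a continuous kernel on `V × S`, as a function of
the kernel. -/
def kernelOp : C(V × S, ℝ) →L[ℝ] Lp ℝ 2 μ →L[ℝ] Lp ℝ 2 ν :=
  LinearMap.mkContinuous₂
    (LinearMap.mk₂ ℝ (fun κ g => contToL2 V ν (innerCont κ g))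
      (fun κ κ' g => by
        rw [← map_add]
        refine congrArg _ (ContinuousMap.ext fun x => ?_)
        rw [ContinuousMap.add_apply, innerCont_apply, innerCont_apply, innerCont_apply,
          ← inner_add_left, ← map_add]
        rfl)
      (fun c κ g => by
        rw [← map_smul]
        refine congrArg _ (ContinuousMap.ext fun x => ?_)
        rw [ContinuousMap.smul_apply, innerCont_apply, innerCont_apply, smul_eq_mul,
          ← real_inner_smul_left, ← map_smul]
        rfl)
      (fun κ g g' => by
        rw [← map_add]
        refine congrArg _ (ContinuousMap.ext fun x => ?_)
        rw [ContinuousMap.add_apply, innerCont_apply, innerCont_apply, innerCont_apply,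
          inner_add_right])
      (fun c κ g => by
        rw [← map_smul]
        refine congrArg _ (ContinuousMap.ext fun x => ?_)
        rw [ContinuousMap.smul_apply, innerCont_apply, innerCont_apply, smul_eq_mul,
          real_inner_smul_right]))
    (‖contToL2 V ν‖ * ‖contToL2 S μ‖) (fun κ g => by
      rw [LinearMap.mk₂_apply, mul_assoc, mul_assoc]
      refine (ContinuousLinearMap.le_opNorm _ _).trans ?_
      gcongr
      rw [ContinuousMap.norm_le _ (by positivity)]
      intro x
      rw [innerCont_apply]
      refine (norm_inner_le_norm _ _).trans ?_
      rw [← mul_assoc]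
      gcongr
      refine (ContinuousLinearMap.le_opNorm _ _).trans ?_
      gcongr
      rw [ContinuousMap.norm_le _ (norm_nonneg _)]
      exact fun y => κ.norm_coe_le_norm (x, y))

theorem kernelOp_apply (κ : C(V × S, ℝ)) (g : Lp ℝ 2 μ) :
    kernelOp V S ν μ κ g = contToL2 V ν (innerCont κ g) := rfl

theorem kernelOp_ae (hV : ∀ᵐ x ∂ν, x ∈ V) (hS : ∀ᵐ y ∂μ, y ∈ S) {κ : C(V × S, ℝ)}
    {k : γ → α → ℝ} (hk : ∀ x : V, ∀ y : S, κ (x, y) = k x y) (g : Lp ℝ 2 μ) :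
    kernelOp V S ν μ κ g =ᵐ[ν] fun x => ∫ y, k x y * g y ∂μ := by
  rw [kernelOp_apply]
  refine contToL2_ae hV fun x => ?_
  rw [innerCont_apply, L2.inner_def]
  refine integral_congr_ae ?_
  filter_upwards [contToL2_ae hS (f := κ.curry x) (g := k x) (fun y => hk x y)] with y hy
  rw [hy]
  simp [mul_comm]

/-- An integral operator with a continuous kernel is compact. -/
theorem isCompactOperator_kernelOp (κ : C(V × S, ℝ)) :
    IsCompactOperator (kernelOp V S ν μ κ) := by
  -- The rows `κ(x, ·)` form a compact subset of `L²`. Projecting first onto the span of a finite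
  -- net of rows gives a finite-rank operator close in norm; radius `ε / (2 * c)` makes the error at
  -- most `ε / 2`.
  set k : V → Lp ℝ 2 μ := fun x => contToL2 S μ (κ.curry x) with hk
  have hkc : Continuous k := by fun_prop
  refine isClosed_setOfPred_isCompactOperator.closure_subset (Metric.mem_closure_iff.2 fun ε hε => ?_)
  set c : ℝ := ‖contToL2 V ν‖ + 1 with hc
  have hc0 : 0 < c := by positivity
  obtain ⟨t, -, ht, hcov⟩ := (isCompact_range hkc).finite_cover_balls (e := ε / (2 * c)) (by positivity)
  have : FiniteDimensional ℝ (Submodule.span ℝ t) := FiniteDimensional.span_of_finite ℝ ht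
  set P := (Submodule.span ℝ t).starProjection with hP
  have : LocallyCompactSpace (Submodule.span ℝ t) :=
    have := FiniteDimensional.proper ℝ (Submodule.span ℝ t)
    inferInstance
  refine ⟨kernelOp V S ν μ κ ∘L P, ?_, ?_⟩
  · exact ((isCompactOperator_id (E := Submodule.span ℝ t)).comp_clm
      (Submodule.span ℝ t).orthogonalProjectionOnto).clm_comp
        (kernelOp V S ν μ κ ∘L (Submodule.span ℝ t).subtypeL)
  · rw [dist_eq_norm]
    refine lt_of_le_of_lt (ContinuousLinearMap.opNorm_le_bound _ (M := c * (ε / (2 * c)))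
      (by positivity) fun g => ?_) (by field_simp; norm_num)
    rw [_root_.sub_apply, ContinuousLinearMap.comp_apply, ← map_sub, kernelOp_apply, mul_assoc]
    refine (ContinuousLinearMap.le_opNorm _ _).trans ?_
    gcongr
    · linarith
    rw [ContinuousMap.norm_le _ (by positivity)]
    intro x
    change ‖inner ℝ (k x) (g - P g)‖ ≤ _
    obtain ⟨a, hat, ha⟩ := mem_iUnion₂.1 (hcov (mem_range_self x))
    have h1 : inner ℝ a (g - P g) = 0 :=
      (Submodule.sub_starProjection_mem_orthogonal g) a (Submodule.subset_span hat)
    have h2 : inner ℝ (k x) (g - P g) = inner ℝ (k x - a) (g - P g) := by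
      rw [inner_sub_left, h1, sub_zero]
    have h3 : ‖g - P g‖ ≤ ‖g‖ := by
      have := (Submodule.span ℝ t)ᗮ.norm_starProjection_apply_le g
      rwa [Submodule.starProjection_orthogonal_val] at this
    rw [h2]
    refine (norm_inner_le_norm _ _).trans ?_
    gcongr
    rw [← dist_eq_norm]
    exact (Metric.mem_ball.1 ha).le

end KernelOperator

/-! ### Identification of `intOp` with the kernel operator -/

section IntOp

variable {d r s : ℕ} {R V : Set (Euc d)}

/-- The operator `intOp` with a kernel that is continuous on `V × R`. -/
theorem intOp_eq (hR : IsCompact R) (hV : IsCompact V) [CompactSpace R] [CompactSpace V]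
    [IsFiniteMeasure (surf r R)] [IsFiniteMeasure (surf s V)] {k : Euc d → Euc d → ℝ}
    {κ : C(V × R, ℝ)} (hk : ∀ x : V, ∀ y : R, κ (x, y) = k x y) :
    intOp r R s V k = kernelOp V R (surf s V) (surf r R) κ ∘L toL2 r R := by
  have hA : ∀ g : H10 r R, (kernelOp V R (surf s V) (surf r R) κ ∘L toL2 r R) g
      =ᵐ[surf s V] fun x => ∫ y, k x y * (toL2 r R g) y ∂(surf r R) := fun g =>
    kernelOp_ae (ae_mem_surf hV) (ae_mem_surf hR) hk _
  have hex : ∃ A : H10 r R →L[ℝ] L2 s V, ∀ g : H10 r R,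
      A g =ᵐ[surf s V] fun x => ∫ y, k x y * (toL2 r R g) y ∂(surf r R) := ⟨_, hA⟩
  rw [intOp, dif_pos hex]
  refine ContinuousLinearMap.ext fun g => Lp.ext ?_
  exact (hex.choose_spec g).trans (hA g).symm

end IntOp

/-! ### Differentiability of the kernel in its parameter, in the uniform norm -/

section Parameter

variable {p : ℕ}

/-- The increment of a function with almost constant partial derivatives, along coordinate
segments. -/
theorem abs_sub_sub_sum_le_of_lineDeriv {f : Euc p → ℝ} {t k : Euc p} {c : Fin p → ℝ} {ε : ℝ}
    (hf : ∀ x ∈ Metric.closedBall t ‖k‖, ∀ i,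
      LineDifferentiableAt ℝ f x (EuclideanSpace.single i 1))
    (hc : ∀ x ∈ Metric.closedBall t ‖k‖, ∀ i,
      |lineDeriv ℝ f x (EuclideanSpace.single i 1) - c i| ≤ ε) :
    |f (t + k) - f t - ∑ i, k i * c i| ≤ ε * p * ‖k‖ := by
  classical
  have hcoord : ∀ i, |k i| ≤ ‖k‖ := fun i => by
    simpa using PiLp.norm_apply_le k i
  -- For `p = 0` the hypothesis on `ε` is empty, so its sign is available only when there is a
  -- coordinate.
  have hε : p ≠ 0 → 0 ≤ ε := fun hp =>
    (abs_nonneg _).trans (hc t (Metric.mem_closedBall_self (norm_nonneg _))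
      ⟨0, Nat.pos_of_ne_zero hp⟩)
  -- Coordinates are switched on one at a time, with the one-variable mean value inequality at each
  -- step. Every intermediate point stays in the ball, since no coordinate of its displacement
  -- exceeds that of `k` in absolute value.
  have key : ∀ T : Finset (Fin p),
      |f (t + ∑ i ∈ T, k i • EuclideanSpace.single i (1 : ℝ)) - f t - ∑ i ∈ T, k i * c i|
        ≤ ε * T.card * ‖k‖ := by
    intro T
    induction T using Finset.induction_on with
    | empty => simp
    | insert j T hj ih =>
      set a : Euc p := t + ∑ i ∈ T, k i • EuclideanSpace.single i (1 : ℝ) with ha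
      set e : Euc p := EuclideanSpace.single j (1 : ℝ) with he
      have hmem : ∀ u ∈ uIcc 0 (k j), a + u • e ∈ Metric.closedBall t ‖k‖ := by
        intro u hu
        have hu' : |u| ≤ |k j| := by
          have := abs_sub_left_of_mem_uIcc hu
          simpa using this
        rw [mem_closedBall_iff_norm, EuclideanSpace.norm_eq, EuclideanSpace.norm_eq]
        refine Real.sqrt_le_sqrt (Finset.sum_le_sum fun i _ => ?_)
        rw [Real.norm_eq_abs, Real.norm_eq_abs]
        refine pow_le_pow_left₀ (abs_nonneg _) ?_ 2
        have hval : (a + u • e - t) i = (if i ∈ T then k i else 0) + if i = j then u else 0 := by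
          rw [ha, add_assoc, add_sub_cancel_left]
          simp [he, Finset.sum_apply, Pi.single_apply]
        rw [hval]
        by_cases hij : i = j
        · subst hij; simpa [hj] using hu'
        · by_cases hiT : i ∈ T <;> simp [hij, hiT]
      have hder : ∀ u ∈ uIcc 0 (k j), HasDerivWithinAt (fun u : ℝ => f (a + u • e) - u * c j)
          (lineDeriv ℝ f (a + u • e) e - c j) (uIcc 0 (k j)) u := by
        intro u hu
        have h1 : HasDerivAt (fun v : ℝ => f (a + u • e + v • e))
            (lineDeriv ℝ f (a + u • e) e) (u - u) := by
          rw [sub_self]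
          exact (hf _ (hmem u hu) j).hasLineDerivAt
        have h2 := HasDerivAt.comp_sub_const u u h1
        have h3 : (fun x : ℝ => f (a + u • e + (x - u) • e)) = fun x => f (a + x • e) := by
          funext x
          congr 1
          rw [add_assoc, ← add_smul, add_sub_cancel]
        rw [h3] at h2
        have h4 := h2.sub ((hasDerivAt_id u).mul_const (c j))
        rw [one_mul] at h4
        exact h4.hasDerivWithinAt
      have hmv := (convex_uIcc (0 : ℝ) (k j)).norm_image_sub_le_of_norm_hasDerivWithin_le hder
        (fun u hu => hc _ (hmem u hu) j) left_mem_uIcc right_mem_uIcc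
      rw [sub_zero, Real.norm_eq_abs, Real.norm_eq_abs, zero_smul, add_zero, zero_mul,
        sub_zero] at hmv
      have hp : p ≠ 0 := fun h => (h ▸ j).elim0
      have hins : t + ∑ i ∈ insert j T, k i • EuclideanSpace.single i (1 : ℝ) = a + k j • e := by
        rw [Finset.sum_insert hj, ha, he]; abel
      rw [hins, Finset.sum_insert hj, Finset.card_insert_of_notMem hj]
      have hmv' : |f (a + k j • e) - k j * c j - f a| ≤ ε * ‖k‖ :=
        hmv.trans (mul_le_mul_of_nonneg_left (hcoord j) (hε hp))
      have hsplit : f (a + k j • e) - f t - (k j * c j + ∑ i ∈ T, k i * c i)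
          = (f (a + k j • e) - k j * c j - f a) + (f a - f t - ∑ i ∈ T, k i * c i) := by ring
      rw [hsplit]
      refine (abs_add_le _ _).trans ((add_le_add hmv' ih).trans (le_of_eq ?_))
      push_cast
      ring
  have hk : ∑ i, k i • EuclideanSpace.single i (1 : ℝ) = k := by
    ext j
    simp [Finset.sum_apply, Pi.single_apply]
  simpa [hk] using key Finset.univ

variable {Z : Type*} [TopologicalSpace Z] [CompactSpace Z]

open Classical in
/-- A function on a compact space, as an element of the Banach space of continuous functions
(zero if it is not continuous). -/
def toCont (f : Z → ℝ) : C(Z, ℝ) := if h : Continuous f then ⟨f, h⟩ else 0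

omit [CompactSpace Z] in
theorem toCont_apply {f : Z → ℝ} (h : Continuous f) (z : Z) : toCont f z = f z := by
  rw [toCont, dif_pos h]; rfl

/-- The map `q ↦ ∑ qᵢ ∂ᵢ h`. -/
def gradCont (h' : Fin p → Euc p → Z → ℝ) (t : Euc p) : Euc p →L[ℝ] C(Z, ℝ) :=
  ∑ i, (EuclideanSpace.proj i : Euc p →L[ℝ] ℝ).smulRight (toCont (h' i t))

theorem gradCont_apply {h' : Fin p → Euc p → Z → ℝ} {t : Euc p}
    (hc : ∀ i, Continuous (h' i t)) (q : Euc p) (z : Z) :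
    gradCont h' t q z = ∑ i, q i * h' i t z := by
  simp [gradCont, ContinuousMap.sum_apply, toCont_apply (hc _)]

omit [CompactSpace Z] in
/-- Joint continuity gives continuity of the curried map for the uniform norm. -/
theorem continuousOn_toCont {T : Type*} [TopologicalSpace T] {U : Set T} {h : T → Z → ℝ}
    (hc : ContinuousOn (fun a : T × Z => h a.1 a.2) (U ×ˢ univ)) :
    ContinuousOn (fun t => toCont (h t)) U ∧ ∀ t ∈ U, Continuous (h t) := by
  have hsec : ∀ t ∈ U, Continuous (h t) := fun t ht => by
    have : Continuous fun z : Z => (t, z) := by fun_prop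
    exact hc.comp_continuous this fun z => ⟨ht, mem_univ z⟩
  refine ⟨?_, hsec⟩
  rw [continuousOn_iff_continuous_domRestrict]
  let F : C(U × Z, ℝ) := ⟨fun a => h a.1 a.2,
    hc.comp_continuous (f := fun a : U × Z => ((a.1 : T), a.2)) (by fun_prop)
      fun a => ⟨a.1.2, mem_univ _⟩⟩
  have : U.domRestrict (fun t => toCont (h t)) = F.curry := by
    funext t
    ext z
    rw [domRestrict_apply, toCont_apply (hsec t t.2)]
    rfl
  rw [this]
  exact F.curry.continuous

/-- A function whose partial derivatives in a parameter exist and are jointly continuous is `C¹`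
as a function of the parameter with values in the continuous functions, near a parameter where it
is continuous. -/
theorem contDiffAt_toCont {h : Euc p → Z → ℝ} {U : Set (Euc p)} (hU : IsOpen U)
    (hd : ∀ i, ∀ t ∈ U, ∀ z,
      LineDifferentiableAt ℝ (fun t => h t z) t (EuclideanSpace.single i 1))
    {h' : Fin p → Euc p → Z → ℝ}
    (hh' : ∀ i t z, h' i t z = lineDeriv ℝ (fun t => h t z) t (EuclideanSpace.single i 1))
    (hc : ∀ i, ContinuousOn (fun a : Euc p × Z => h' i a.1 a.2) (U ×ˢ univ))
    {m : Euc p} (hm : m ∈ U) (hmc : Continuous (h m)) :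
    ContDiffAt ℝ 1 (fun t => toCont (h t)) m ∧
      fderiv ℝ (fun t => toCont (h t)) m = gradCont h' m ∧
      ∀ᶠ t in 𝓝 m, Continuous (h t) := by
  obtain ⟨ρ, hρ, hball⟩ := Metric.nhds_basis_closedBall.mem_iff.1 (hU.mem_nhds hm)
  -- Continuity in `z` is assumed only at the parameter `m`. It propagates to nearby `t` because `h
  -- t z - h t z₀` changes little between `m` and `t`: its partial derivatives are small, uniformly
  -- on the compact ball of parameters, when `z` is near `z₀`.
  have hsec : ∀ t ∈ Metric.closedBall m ρ, Continuous (h t) := by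
    intro t ht
    rw [continuous_iff_continuousAt]
    intro z₀
    rw [Metric.continuousAt_iff']
    intro ε hε
    set θ : ℝ := ε / 2 / (p * ρ + 1) with hθ
    have hθ0 : 0 < θ := by positivity
    have hK : CompactSpace (Metric.closedBall m ρ) :=
      isCompact_iff_compactSpace.1 (isCompact_closedBall m ρ)
    have h1 : ∀ᶠ z in 𝓝 z₀, ∀ i, ∀ s ∈ Metric.closedBall m ρ, |h' i s z - h' i s z₀| < θ := by
      refine eventually_all.2 fun i => ?_
      let F : C(Z × Metric.closedBall m ρ, ℝ) := ⟨fun a => h' i a.2 a.1,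
        (hc i).comp_continuous (f := fun a : Z × Metric.closedBall m ρ => ((a.2 : Euc p), a.1))
          (by fun_prop) fun a => ⟨hball a.2.2, mem_univ _⟩⟩
      have := Metric.continuousAt_iff'.1 (F.curry.continuous.continuousAt (x := z₀)) θ hθ0
      filter_upwards [this] with z hz s hs
      exact (ContinuousMap.dist_apply_le_dist (f := F.curry z) (g := F.curry z₀) ⟨s, hs⟩).trans_lt hz
    have h2 : ∀ᶠ z in 𝓝 z₀, dist (h m z) (h m z₀) < ε / 2 :=
      Metric.continuousAt_iff'.1 hmc.continuousAt _ (by positivity)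
    filter_upwards [h1, h2] with z k1 k2
    have hk : ‖t - m‖ ≤ ρ := mem_closedBall_iff_norm.1 ht
    have hsub : Metric.closedBall m ‖t - m‖ ⊆ Metric.closedBall m ρ :=
      Metric.closedBall_subset_closedBall hk
    have key := abs_sub_sub_sum_le_of_lineDeriv (f := fun t => h t z - h t z₀) (t := m)
      (k := t - m) (c := 0) (ε := θ)
      (fun x hx i => (hd i x (hball (hsub hx)) z).sub (hd i x (hball (hsub hx)) z₀))
      (fun x hx i => by
        have e : lineDeriv ℝ (fun t => h t z - h t z₀) x (EuclideanSpace.single i 1)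
            = h' i x z - h' i x z₀ := by
          rw [hh', hh']
          exact HasLineDerivAt.lineDeriv (HasDerivAt.sub
            (hd i x (hball (hsub hx)) z).hasLineDerivAt
            (hd i x (hball (hsub hx)) z₀).hasLineDerivAt)
        rw [e, Pi.zero_apply, sub_zero]
        exact (k1 i x (hsub hx)).le)
    simp only [add_sub_cancel, Pi.zero_apply, mul_zero, Finset.sum_const_zero, sub_zero] at key
    have hle : θ * p * ‖t - m‖ ≤ ε / 2 := by
      calc θ * p * ‖t - m‖ ≤ θ * (p * ρ + 1) := by
            rw [mul_assoc]; gcongr; nlinarith [mul_le_mul_of_nonneg_left hk p.cast_nonneg]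
        _ = ε / 2 := by rw [hθ, div_mul_cancel₀ _ (by positivity)]
    rw [Real.dist_eq] at k2 ⊢
    have hsplit : h t z - h t z₀ = (h t z - h t z₀ - (h m z - h m z₀)) + (h m z - h m z₀) := by
      ring
    rw [hsplit]
    exact (abs_add_le _ _).trans_lt (by linarith)
  have hGc : ContinuousOn (gradCont h') U := by
    unfold gradCont
    refine continuousOn_finsetSum _ fun i _ => ?_
    have := (continuousOn_toCont (hc i)).1
    exact ((ContinuousLinearMap.smulRightL ℝ (Euc p) C(Z, ℝ)
      (EuclideanSpace.proj i : Euc p →L[ℝ] ℝ)).continuous.comp_continuousOn this)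
  have hh'c : ∀ i, ∀ t ∈ U, Continuous (h' i t) := fun i => (continuousOn_toCont (hc i)).2
  have hballU : Metric.ball m ρ ⊆ U := Metric.ball_subset_closedBall.trans hball
  have hder : ∀ t ∈ Metric.ball m ρ,
      HasFDerivAt (fun t => toCont (h t)) (gradCont h' t) t := by
    intro t ht
    refine HasFDerivAt.of_isLittleO (Asymptotics.isLittleO_iff.2 fun ε hε => ?_)
    set θ : ℝ := ε / (p + 1) with hθ
    have hθ0 : 0 < θ := by positivity
    have h1 : ∀ᶠ s in 𝓝 t, s ∈ Metric.ball m ρ ∧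
        ∀ i, dist (toCont (h' i s)) (toCont (h' i t)) < θ := by
      refine Eventually.and (Metric.isOpen_ball.mem_nhds ht) (eventually_all.2 fun i => ?_)
      exact Metric.continuousAt_iff'.1 ((continuousOn_toCont (hc i)).1.continuousAt
        (hU.mem_nhds (hballU ht))) θ hθ0
    obtain ⟨τ, hτ, hτball⟩ := Metric.nhds_basis_closedBall.eventually_iff.1 h1
    filter_upwards [Metric.closedBall_mem_nhds t hτ] with s hs
    rw [ContinuousMap.norm_le _ (by positivity)]
    intro z
    have hsub : Metric.closedBall t ‖s - t‖ ⊆ Metric.closedBall t τ :=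
      Metric.closedBall_subset_closedBall (mem_closedBall_iff_norm.1 hs)
    have key := abs_sub_sub_sum_le_of_lineDeriv (f := fun t => h t z) (t := t)
      (k := s - t) (c := fun i => h' i t z) (ε := θ)
      (fun x hx i => hd i x (hballU (hτball (hsub hx)).1) z)
      (fun x hx i => by
        have := (ContinuousMap.dist_apply_le_dist z).trans_lt ((hτball (hsub hx)).2 i)
        rw [toCont_apply (hh'c i x (hballU (hτball (hsub hx)).1)),
          toCont_apply (hh'c i t (hballU ht)), Real.dist_eq] at this
        rw [← hh']
        exact this.le)
    rw [add_sub_cancel] at key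
    rw [ContinuousMap.sub_apply, ContinuousMap.sub_apply,
      toCont_apply (hsec s (Metric.ball_subset_closedBall (hτball hs).1)),
      toCont_apply (hsec t (Metric.ball_subset_closedBall ht)),
      gradCont_apply fun i => hh'c i t (hballU ht)]
    refine key.trans ?_
    gcongr
    rw [hθ, div_mul_eq_mul_div, div_le_iff₀ (by positivity)]
    nlinarith
  refine ⟨contDiffAt_one_iff.2 ⟨gradCont h', Metric.ball m ρ, Metric.ball_mem_nhds m hρ,
    hGc.mono hballU, hder⟩, (hder m (Metric.mem_ball_self hρ)).fderiv, ?_⟩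
  filter_upwards [Metric.closedBall_mem_nhds m hρ] with t ht using hsec t ht

end Parameter

/-! ### Transfer through bounded linear maps -/

section Composition

variable {M C X Y Z : Type*} [NormedAddCommGroup M] [NormedSpace ℝ M] [NormedAddCommGroup C]
  [NormedSpace ℝ C] [NormedAddCommGroup X] [NormedSpace ℝ X] [NormedAddCommGroup Y]
  [NormedSpace ℝ Y] [NormedAddCommGroup Z] [NormedSpace ℝ Z]

theorem contDiffAt_clm_comp (K : C →L[ℝ] Y →L[ℝ] Z) (T : X →L[ℝ] Y) {f : M → C} {m : M}
    (hf : ContDiffAt ℝ 1 f m) :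
    ContDiffAt ℝ 1 (fun t => K (f t) ∘L T) m ∧
      ∀ q, fderiv ℝ (fun t => K (f t) ∘L T) m q = K (fderiv ℝ f m q) ∘L T := by
  let L : C →L[ℝ] X →L[ℝ] Z := (ContinuousLinearMap.compL ℝ X Y Z).flip T ∘L K
  refine ⟨L.contDiff.contDiffAt.comp m hf, fun q => ?_⟩
  have h : HasFDerivAt (fun t => K (f t) ∘L T) (L ∘L fderiv ℝ f m) m :=
    L.hasFDerivAt.comp m (hf.differentiableAt one_ne_zero).hasFDerivAt
  rw [h.fderiv]
  rfl

theorem isCompactOperator_comp {K : Y →L[ℝ] Z} (hK : IsCompactOperator K) (T : X →L[ℝ] Y) :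
    IsCompactOperator (K ∘L T) :=
  hK.comp_clm T

end Composition

/-! ### Regularity of the operators `A_m` -/

section KernelFamily

variable {d p r s : ℕ} {R V : Set (Euc d)} {H : Euc p → Euc d → Euc d → ℝ}
  {B B' : Set (Euc p)}

/-- The operators `A_m` are compact and `C¹` in `m` near `B`, with derivative `q ↦ ∂_q A_m`. -/
theorem contDiffAt_opA (hR : IsCompact R) (hRmfd : IsSubmanifold r R) (hV : IsCompact V)
    (hVmfd : IsSubmanifold s V) (hB' : IsOpen B') (hBB' : B ⊆ B')
    (hH : ContinuousOn (fun z : Euc p × Euc d × Euc d => H z.1 z.2.1 z.2.2) (B ×ˢ V ×ˢ R))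
    (hdH : ∀ i : Fin p, ∀ m ∈ B', ∀ x ∈ V, ∀ y ∈ R,
      LineDifferentiableAt ℝ (fun m' => H m' x y) m (EuclideanSpace.single i 1))
    (hdHcont : ∀ i : Fin p,
      ContinuousOn (fun z : Euc p × Euc d × Euc d => paramDeriv H i z.1 z.2.1 z.2.2)
        (B' ×ˢ V ×ˢ R))
    {m : Euc p} (hm : m ∈ B) :
    ContDiffAt ℝ 1 (opA r R s V H) m ∧ (∀ q, fderiv ℝ (opA r R s V H) m q = opDA r R s V H q m) ∧
      ∀ᶠ t in 𝓝 m, IsCompactOperator (opA r R s V H t) := by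
  have := isFiniteMeasure_surf hR hRmfd
  have := isFiniteMeasure_surf hV hVmfd
  have : CompactSpace R := isCompact_iff_compactSpace.1 hR
  have : CompactSpace V := isCompact_iff_compactSpace.1 hV
  set h : Euc p → V × R → ℝ := fun t z => H t z.1 z.2 with hh
  set h' : Fin p → Euc p → V × R → ℝ := fun i t z => paramDeriv H i t z.1 z.2 with hh'
  have hc : ∀ i, ContinuousOn (fun a : Euc p × (V × R) => h' i a.1 a.2) (B' ×ˢ univ) := fun i =>
    (hdHcont i).comp (f := fun a : Euc p × (V × R) => (a.1, (a.2.1 : Euc d), (a.2.2 : Euc d)))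
      (by fun_prop) fun a ha => ⟨ha.1, a.2.1.2, a.2.2.2⟩
  have hmc : Continuous (h m) :=
    hH.comp_continuous (f := fun a : V × R => (m, (a.1 : Euc d), (a.2 : Euc d)))
      (by fun_prop) fun a => ⟨hm, a.1.2, a.2.2⟩
  obtain ⟨h1, h2, h3⟩ := contDiffAt_toCont hB'
    (fun i t ht z => hdH i t ht z.1 z.1.2 z.2 z.2.2) (fun i t z => rfl) hc (hBB' hm) hmc
  -- Only a local identity: for parameters away from `m` the kernel need not be continuous on `V ×
  -- R`.
  have heq : opA r R s V H =ᶠ[𝓝 m]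
      fun t => kernelOp V R (surf s V) (surf r R) (toCont (h t)) ∘L toL2 r R := by
    filter_upwards [h3] with t ht
    exact intOp_eq hR hV fun x y => toCont_apply ht (x, y)
  obtain ⟨h4, h5⟩ := contDiffAt_clm_comp (kernelOp V R (surf s V) (surf r R)) (toL2 r R) h1
  refine ⟨h4.congr_of_eventuallyEq heq, fun q => ?_, ?_⟩
  · rw [heq.fderiv_eq, h5, h2, opDA]
    refine (intOp_eq hR hV fun x y => ?_).symm
    exact gradCont_apply (fun i => (continuousOn_toCont (hc i)).2 m (hBB' hm)) q (x, y)
  · filter_upwards [heq] with t ht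
    rw [ht]
    exact isCompactOperator_comp (isCompactOperator_kernelOp _) _

end KernelFamily

end StabInv

end

theorem mainTheorem5 (d p r s : ℕ)
    (R V : Set (Euc d))
    (hR : IsCompact R) (hRmfd : IsSubmanifold r R)
    (hRbdry : ∀ y ∈ R, (connectedComponentIn R y ∩ bdry r R).Nonempty)
    (hV : IsCompact V) (hVmfd : IsSubmanifold s V)
    (H : Euc p → Euc d → Euc d → ℝ)
    (B B' : Set (Euc p)) (hB : IsCompact B) (hB' : IsOpen B') (hBB' : B ⊆ B')
    (hH : ContinuousOn (fun z : Euc p × Euc d × Euc d => H z.1 z.2.1 z.2.2) (B ×ˢ V ×ˢ R))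
    (hdH : ∀ i : Fin p, ∀ m ∈ B', ∀ x ∈ V, ∀ y ∈ R,
      LineDifferentiableAt ℝ (fun m' => H m' x y) m (EuclideanSpace.single i 1))
    (hdHcont : ∀ i : Fin p,
      ContinuousOn (fun z : Euc p × Euc d × Euc d => paramDeriv H i z.1 z.2.1 z.2.2)
        (B' ×ˢ V ×ˢ R))
    (hU1 : ∀ m₁ ∈ B, ∀ m₂ ∈ B, ∀ u v : H10 r R,
      opA r R s V H m₁ u = opA r R s V H m₂ v → (u ≠ 0 ∨ v ≠ 0) → m₁ = m₂ ∧ u = v)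
    (hU2 : ∀ q : Euc p, ‖q‖ = 1 → ∀ m ∈ B, ∀ u v : H10 r R,
      opDA r R s V H q m u = opA r R s V H m v → u = 0 ∧ v = 0)
    (β : ℝ) (hβ : 0 < β) (hβB : ∀ m ∈ B, β ^ 2 < ‖gram (opA r R s V H m)‖)
    (A₁ A₂ : ℝ) (hA₁ : 0 < A₁) (hA₂ : 0 < A₂)
    (m₀ : Euc p) (hm₀ : m₀ ∈ B) :
    -- on each `W` the projections are `C^1` and the infimum of the distances is positive
    (∀ W : Set (Euc p), IsGoodNhd (opA r R s V H) β B m₀ W →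
      (∀ m ∈ W, ContDiffAt ℝ 1 (fun t => highProj (opA r R s V H t) β) m) ∧
      0 < infDist (opA r R s V H) (opDA r R s V H) β A₁ A₂ W) ∧
    -- the stability constant on `W` is asymptotically the infimum as `W` shrinks to `m₀`
    (∀ ε : ℝ, 0 < ε → ε < 1 → ∃ δ : ℝ, 0 < δ ∧
      ∀ W : Set (Euc p), IsGoodNhd (opA r R s V H) β B m₀ W → W ⊆ Metric.closedBall m₀ δ →
        IsStabilityConst (opA r R s V H) β A₁ A₂ W
          (ENNReal.ofReal (1 - ε) * infDist (opA r R s V H) (opDA r R s V H) β A₁ A₂ W) ∧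
        (m₀ ∈ interior B → ∀ C : ℝ≥0∞,
          IsStabilityConst (opA r R s V H) β A₁ A₂ W C →
          C ≤ ENNReal.ofReal (1 + ε) *
            infDist (opA r R s V H) (opDA r R s V H) β A₁ A₂ W)) := by
  have h : ∀ m ∈ B, _ := fun m hm =>
    contDiffAt_opA hR hRmfd hV hVmfd hB' hBB' hH hdH hdHcont hm
  exact stability_of_contDiffAt hB (fun m hm => (h m hm).1) (fun m hm => (h m hm).2.1)
    (fun m hm => (h m hm).2.2) hU2 hβ hA₁ hA₂ hm₀
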